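/- \textbf{Setting.} Let $V_{\mathbb Z}=\mathbb Z^m$, let $Q$ be an integral bilinear form on $V_{\mathbb Z}$, and let $V_{\mathbb C}=\bigoplus_{p+q=k}V_0^{p,q}$ be a Hodge structure $h_0$ of weight $k$ on $V_{\mathbb Z}$ polarized by $Q$: $Q$ is $(-1)^k$-symmetric, $Q(V_0^{p,q},V_0^{p',q'})=0$ unless $p'=q$, and $i^{p-q}Q(v,\bar v)>0$ for $0\neq v\in V_0^{p,q}$. Let $\mathbf G\subset \mathrm{GL}(V_{\mathbb Q})$ be a $\mathbb Q$-algebraic group of similitudes of $Q$ that contains the Mumford--Tate group of $h_0$, i.e. $\mathbf G(\mathbb R)$ contains all operators acting by $z^p\bar z^q$ on $V_0^{p,q}$, $z\in\mathbb C^\times$. Write $\mathbf G(\mathbb R)^+$ for the identity component of $\mathbf G(\mathbb R)$ and $K$ for the stabilizer of $h_0$ in it, with Lie algebras $\mathfrak g$ and $\mathfrak k$. The orbit $\mathbb D=\mathbf G(\mathbb R)^+\cdot h_0=\mathbf G(\mathbb R)^+/K$ is called a \emph{period domain of rank $m$}. (If $\mathbf G$ is the Mumford--Tate group of $h_0$,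 this is a Mumford--Tate domain; if $\mathbf G$ consists of all similitudes of $Q$, it is a connected component of the classifying space of $Q$-polarized Hodge structures.) An \emph{arithmetic group acting on $\mathbb D$} is a subgroup $\Gamma\subset\mathbf G(\mathbb Q)$, commensurable with $\mathbf G(\mathbb Z)$, that maps $\mathbb D$ into itself. An element $\gamma$ is \emph{quasi-unipotent} if $\gamma^N$ is unipotent for some $N\geq 1$. A $\mathbf G(\mathbb R)^+$-invariant Riemannian metric $b$ on $\mathbb D$ is the same as an $\mathrm{Ad}(K)$-invariant inner product $b$ on $\mathfrak g/\mathfrak k$; let $d_{\mathbb D}$ be its Riemannian distance. The \emph{Hodge metric} is the one given by $\|X\|_{\rm Hodge}^2=\mathrm{tr}(X'X'^{*})$, where $X'$ is the component of $X$ in $\bigoplus_{r\neq 0}\mathrm{End}(V_{\mathbb C})^{r,-r}$ and the adjoint is taken for the Hodge inner product $\langle u,v\rangle=Q(Cu,\bar v)$, with $C=i^{p-q}$ on $V_0^{p,q}$. \textbf{Lemma.} For every $n$ there is a constant $\mu_n>0$, depending only on $n$, such that the following holds. Let $\mathbb D$ be a period domain of rank at most $n$ with an invariant Riemannian metric $b$,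 let $c>0$ be such that $b(X,X)\geq c^2\|X\|_{\rm Hodge}^2$ for all $X\in\mathfrak g$, and let $\Gamma$ be an arithmetic group acting on $\mathbb D$. Then for every $p\in\mathbb D$ $$d_{\mathbb D}(p,\gamma p)>c\,\mu_n\qquad\text{for all non-quasi-unipotent }\gamma\in\Gamma .$$ In particular $d_{\mathbb D}(p,\gamma p)>\mu_n$ if $d_{\mathbb D}$ is the distance of the Hodge metric. -/

import Mathlib

open Matrix

noncomputable section

namespace PeriodDomain

/-- Extension of scalars `GL_m(ℝ) → GL_m(ℂ)`. -/
def toC {m : ℕ} : GL (Fin m) ℝ →* GL (Fin m) ℂ :=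
  Matrix.GeneralLinearGroup.map (algebraMap ℝ ℂ)

/-- Extension of scalars `GL_m(ℚ) → GL_m(ℝ)`. -/
def ratToReal {m : ℕ} : GL (Fin m) ℚ →* GL (Fin m) ℝ :=
  Matrix.GeneralLinearGroup.map (algebraMap ℚ ℝ)

/-- Extension of scalars `GL_m(ℤ) → GL_m(ℚ)`. -/
def intToRat {m : ℕ} : GL (Fin m) ℤ →* GL (Fin m) ℚ :=
  Matrix.GeneralLinearGroup.map (algebraMap ℤ ℚ)

/-- Complex conjugation of a matrix, entry by entry. -/
def conjM {m : ℕ} (A : Matrix (Fin m) (Fin m) ℂ) : Matrix (Fin m) (Fin m) ℂ :=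
  A.map (starRingEnd ℂ)

/-- The complexification of a real matrix. -/
def cplx {m : ℕ} (A : Matrix (Fin m) (Fin m) ℝ) : Matrix (Fin m) (Fin m) ℂ :=
  A.map (algebraMap ℝ ℂ)

/-- A real Hodge structure of weight `k` on `ℝ^m`: a decomposition `ℂ^m = ⨁_p V^{p,k-p}` with
`conj V^{p,q} = V^{q,p}`. It is recorded by its projectors: `proj p` is the projection of `ℂ^m` onto
`V^{p,k-p}` along the other summands, so that `V^{p,k-p}` is the image of `proj p`. -/
@[ext]
structure HodgeStructure (m : ℕ) (k : ℤ) where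
  proj : ℤ →₀ Matrix (Fin m) (Fin m) ℂ
  proj_idem : ∀ p, proj p * proj p = proj p
  proj_orth : ∀ p q, p ≠ q → proj p * proj q = 0
  proj_sum : (proj.sum fun _ P => P) = 1
  proj_conj : ∀ p, conjM (proj p) = proj (k - p)

namespace HodgeStructure

variable {m : ℕ} {k : ℤ}

/-- The summand `V^{p,k-p}` of the Hodge decomposition. -/
def piece (h : HodgeStructure m k) (p : ℤ) : Submodule ℂ (Fin m → ℂ) :=
  LinearMap.range (Matrix.mulVecLin (h.proj p))

/-- The action of `z ∈ ℂˣ` (the circle action together with the weight homotheties): it is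
multiplication by `z ^ p * conj z ^ (k - p)` on `V^{p,k-p}`. -/
def deligne (h : HodgeStructure m k) (z : ℂ) : Matrix (Fin m) (Fin m) ℂ :=
  h.proj.sum fun p P => (z ^ p * (starRingEnd ℂ z) ^ (k - p)) • P

/-- The Weil operator: multiplication by `i ^ (p - q)` on `V^{p,q}`, where `q = k - p`. -/
def weil (h : HodgeStructure m k) : Matrix (Fin m) (Fin m) ℂ :=
  h.proj.sum fun p P => (Complex.I ^ (p - (k - p))) • P

/-- `Q` polarizes `h`: it is `(-1)^k`-symmetric, `Q(V^{p,q}, V^{p',q'}) = 0` unless `p' = q`, and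
`i^{p-q} Q(v, conj v) > 0` for `0 ≠ v ∈ V^{p,q}`. -/
structure IsPolarizedBy (h : HodgeStructure m k) (Q : Matrix (Fin m) (Fin m) ℤ) : Prop where
  symm : Qᵀ = (k.negOnePow : ℤ) • Q
  orth : ∀ p p', p + p' ≠ k → ∀ v ∈ h.piece p, ∀ w ∈ h.piece p',
    v ⬝ᵥ (Q.map (Int.cast : ℤ → ℂ)) *ᵥ w = 0
  pos : ∀ p, ∀ v ∈ h.piece p, v ≠ 0 →
    0 < (Complex.I ^ (p - (k - p)) * (v ⬝ᵥ (Q.map (Int.cast : ℤ → ℂ)) *ᵥ (star v))).re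

/-- The action of `g ∈ GL_m(ℝ)` on Hodge structures: `(g • V)^{p,q} = g (V^{p,q})`. -/
def act (g : GL (Fin m) ℝ) (h : HodgeStructure m k) : HodgeStructure m k where
  proj := h.proj.mapRange
    (fun P => (toC g : Matrix (Fin m) (Fin m) ℂ) * P * ((toC g)⁻¹ : GL (Fin m) ℂ)) (by simp)
  proj_idem p := by
    have := h.proj_idem p
    simp only [Finsupp.mapRange_apply]
    calc _ = (toC g : Matrix (Fin m) (Fin m) ℂ) * h.proj p *
          ((((toC g)⁻¹ : GL (Fin m) ℂ) : Matrix (Fin m) (Fin m) ℂ) * (toC g)) * h.proj p *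
          ((toC g)⁻¹ : GL (Fin m) ℂ) := by simp only [Matrix.mul_assoc]
      _ = _ := by rw [Units.inv_mul, Matrix.mul_one, Matrix.mul_assoc _ (h.proj p) (h.proj p), this]
  proj_orth p q hpq := by
    have := h.proj_orth p q hpq
    simp only [Finsupp.mapRange_apply]
    calc _ = (toC g : Matrix (Fin m) (Fin m) ℂ) * h.proj p *
          ((((toC g)⁻¹ : GL (Fin m) ℂ) : Matrix (Fin m) (Fin m) ℂ) * (toC g)) * h.proj q *
          ((toC g)⁻¹ : GL (Fin m) ℂ) := by simp only [Matrix.mul_assoc]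
      _ = _ := by
        rw [Units.inv_mul, Matrix.mul_one, Matrix.mul_assoc _ (h.proj p), this]; simp
  proj_sum := by
    rw [Finsupp.sum_mapRange_index (by simp)]
    have := h.proj_sum
    simp only [Finsupp.sum] at this ⊢
    rw [← Finset.sum_mul, ← Finset.mul_sum, this, Matrix.mul_one, Units.mul_inv]
  proj_conj p := by
    have key : ∀ u : GL (Fin m) ℝ,
        conjM (toC u : Matrix (Fin m) (Fin m) ℂ) = (toC u : Matrix (Fin m) (Fin m) ℂ) := by
      intro u
      ext i j
      simp [conjM, toC]
    have hinv : ((toC g)⁻¹ : GL (Fin m) ℂ) = toC g⁻¹ := by simp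
    simp only [Finsupp.mapRange_apply]
    rw [hinv, ← h.proj_conj p]
    have hmul : ∀ A B : Matrix (Fin m) (Fin m) ℂ, conjM (A * B) = conjM A * conjM B :=
      fun A B => Matrix.map_mul
    rw [hmul, hmul, key, key]

/-- The component of `X ∈ End(ℝ^m)` in `⨁_{r ≠ 0} End(V)^{r,-r}`. -/
def offDiag (h : HodgeStructure m k) (X : Matrix (Fin m) (Fin m) ℝ) :
    Matrix (Fin m) (Fin m) ℂ :=
  cplx X - h.proj.sum fun _ P => P * cplx X * P

/-- The Gram matrix of the Hodge inner product `⟨u, v⟩ = Q(C u, conj v)`, `C` the Weil operator. -/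
def gram (h : HodgeStructure m k) (Q : Matrix (Fin m) (Fin m) ℤ) : Matrix (Fin m) (Fin m) ℂ :=
  h.weilᵀ * Q.map (Int.cast : ℤ → ℂ)

/-- The Hodge metric at `h`: the square `tr(X' X'^*)` of the Hilbert-Schmidt norm, for the Hodge inner
product, of the component `X'` of `X` transverse to the endomorphisms that preserve every `V^{p,q}`.
Here `X'^* = S⁻¹ X'ᴴ S` is the adjoint, `S` being the (real, positive definite) Gram matrix. -/
def hodgeSq (h : HodgeStructure m k) (Q : Matrix (Fin m) (Fin m) ℤ)
    (X : Matrix (Fin m) (Fin m) ℝ) : ℝ :=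
  (h.offDiag X * ((h.gram Q)⁻¹ * (h.offDiag X)ᴴ * h.gram Q)).trace.re

end HodgeStructure

/-- `G ⊆ GL_m(ℂ)` is the group of complex points of a linear algebraic group defined over `ℚ`. -/
def IsQAlgebraic {m : ℕ} (G : Subgroup (GL (Fin m) ℂ)) : Prop :=
  ∃ I : Set (MvPolynomial (Fin m × Fin m) ℚ), ∀ g : GL (Fin m) ℂ,
    g ∈ G ↔ ∀ P ∈ I, MvPolynomial.aeval (fun ij : Fin m × Fin m => g ij.1 ij.2) P = 0

/-- The data defining a period domain of polarized `ℤ`-Hodge structures of rank `m`: a weight, a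
polarization form `Q` on the lattice `ℤ^m`, a `ℚ`-algebraic group `G` of similitudes of `Q`, and a
Hodge structure `base` on `ℤ^m`, polarized by `Q`, whose Mumford-Tate group is contained in `G`
(that is, `G` contains the image of `ℂˣ`). For `G` the Mumford-Tate group of `base` this gives the
Mumford-Tate domains, and for `G` the group of all similitudes of `Q` it gives the connected
components of the classifying spaces of `Q`-polarized Hodge structures with given Hodge numbers. -/
structure Datum (m : ℕ) where
  k : ℤ
  Q : Matrix (Fin m) (Fin m) ℤ
  G : Subgroup (GL (Fin m) ℂ)
  base : HodgeStructure m k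
  polarized : base.IsPolarizedBy Q
  algebraic : IsQAlgebraic G
  similitude : ∀ g ∈ G, ∃ ν : ℂ, (g : Matrix (Fin m) (Fin m) ℂ)ᵀ * Q.map (Int.cast : ℤ → ℂ) * g
    = ν • Q.map (Int.cast : ℤ → ℂ)
  hodge : ∀ z : ℂ, z ≠ 0 → ∃ g ∈ G, (g : Matrix (Fin m) (Fin m) ℂ) = base.deligne z

namespace Datum

variable {m : ℕ} (𝒟 : Datum m)

/-- The real points `G(ℝ)`. -/
def realPoints : Subgroup (GL (Fin m) ℝ) := 𝒟.G.comap toC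

/-- The rational points `G(ℚ)`. -/
def ratPoints : Subgroup (GL (Fin m) ℚ) := 𝒟.realPoints.comap ratToReal

/-- The integral points `G(ℤ)`, as a subgroup of `GL_m(ℚ)`. -/
def intPoints : Subgroup (GL (Fin m) ℚ) := 𝒟.ratPoints ⊓ (intToRat (m := m)).range

/-- The identity component `G(ℝ)⁺` of the real Lie group `G(ℝ)`. -/
def realPlus : Subgroup (GL (Fin m) ℝ) :=
  (Subgroup.connectedComponentOfOne 𝒟.realPoints).map 𝒟.realPoints.subtype

/-- The period domain: the `G(ℝ)⁺`-orbit of the base Hodge structure. -/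
def domain : Set (HodgeStructure m 𝒟.k) :=
  {p | ∃ g ∈ 𝒟.realPlus, p = HodgeStructure.act g 𝒟.base}

/-- The Lie algebra of `G(ℝ)`: the velocities at `1` of curves in `G(ℝ)⁺`. -/
def lie : Set (Matrix (Fin m) (Fin m) ℝ) :=
  {X | ∃ u : ℝ → GL (Fin m) ℝ, u 0 = 1 ∧ (∀ t, u t ∈ 𝒟.realPlus) ∧
    ∀ i j, HasDerivAt (fun t => u t i j) (X i j) 0}

/-- The isotropy group of the base point in `G(ℝ)⁺`. -/
def isotropy : Set (GL (Fin m) ℝ) :=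
  {g | g ∈ 𝒟.realPlus ∧ HodgeStructure.act g 𝒟.base = 𝒟.base}

/-- The Lie algebra of the isotropy group: the elements that preserve every `V^{p,q}`. -/
def isotropyLie : Set (Matrix (Fin m) (Fin m) ℝ) :=
  {X | X ∈ 𝒟.lie ∧ ∀ p, Commute (cplx X) (𝒟.base.proj p)}

/-- A `G(ℝ)⁺`-invariant Riemannian metric on the domain `G(ℝ)⁺/K`, that is, an `Ad(K)`-invariant
inner product on `Lie(G)/Lie(K)`, written as a symmetric bilinear form that is positive semidefinite
on `Lie(G)` with radical `Lie(K)` there. (Its values outside `Lie(G)` are never used.) -/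
structure InvariantMetric where
  form : LinearMap.BilinForm ℝ (Matrix (Fin m) (Fin m) ℝ)
  symm : ∀ X Y, form X Y = form Y X
  nonneg : ∀ X ∈ 𝒟.lie, 0 ≤ form X X
  eq_zero_iff : ∀ X ∈ 𝒟.lie, form X X = 0 ↔ X ∈ 𝒟.isotropyLie
  invariant : ∀ g ∈ 𝒟.isotropy, ∀ X ∈ 𝒟.lie, ∀ Y ∈ 𝒟.lie,
    form ((g : Matrix (Fin m) (Fin m) ℝ) * X * (g⁻¹ : GL (Fin m) ℝ))
      ((g : Matrix (Fin m) (Fin m) ℝ) * Y * (g⁻¹ : GL (Fin m) ℝ)) = form X Y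

/-- A `C¹` path `t ↦ u t • base`, `t ∈ [0,1]`, in the domain from `p` to `q`, given by a `C¹` lift `u`
to `G(ℝ)⁺`. -/
structure IsPath (u : ℝ → GL (Fin m) ℝ) (p q : HodgeStructure m 𝒟.k) : Prop where
  mem : ∀ t ∈ Set.Icc (0 : ℝ) 1, u t ∈ 𝒟.realPlus
  smooth : ∀ i j, ContDiffOn ℝ 1 (fun t => u t i j) (Set.Icc (0 : ℝ) 1)
  source : HodgeStructure.act (u 0) 𝒟.base = p
  target : HodgeStructure.act (u 1) 𝒟.base = q

/-- The left-translated velocity `u(t)⁻¹ u'(t) ∈ Lie(G)` of a path on `[0,1]`. -/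
def velocity (u : ℝ → GL (Fin m) ℝ) (t : ℝ) : Matrix (Fin m) (Fin m) ℝ :=
  (((u t)⁻¹ : GL (Fin m) ℝ) : Matrix (Fin m) (Fin m) ℝ) *
    Matrix.of fun i j => derivWithin (fun s => u s i j) (Set.Icc (0 : ℝ) 1) t

namespace InvariantMetric

variable {𝒟} (b : 𝒟.InvariantMetric)

/-- The Riemannian length of the path `t ↦ u t • base`. -/
def length (u : ℝ → GL (Fin m) ℝ) : ℝ :=
  ∫ t in (0 : ℝ)..1, Real.sqrt (b.form (velocity u t) (velocity u t))

/-- The Riemannian distance: the infimum of the lengths of paths from `p` to `q`. -/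
def dist (p q : HodgeStructure m 𝒟.k) : ENNReal :=
  ⨅ (u : ℝ → GL (Fin m) ℝ) (_ : 𝒟.IsPath u p q), ENNReal.ofReal (b.length u)

/-- The norm of the invariant metric is at least `c` times that of the Hodge metric. -/
def Dominates (c : ℝ) : Prop :=
  ∀ X ∈ 𝒟.lie, c ^ 2 * 𝒟.base.hodgeSq 𝒟.Q X ≤ b.form X X

end InvariantMetric

/-- `Γ` is an arithmetic subgroup of `G`, commensurable with `G(ℤ)`, that acts on the domain. -/
structure IsArithmetic (Γ : Subgroup (GL (Fin m) ℚ)) : Prop where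
  le : Γ ≤ 𝒟.ratPoints
  commensurable : Subgroup.Commensurable Γ 𝒟.intPoints
  maps : ∀ γ ∈ Γ, ∀ p ∈ 𝒟.domain, HodgeStructure.act (ratToReal γ) p ∈ 𝒟.domain

end Datum

/-- `γ` is quasi-unipotent: some positive power of it is unipotent. -/
def IsQuasiUnipotent {m : ℕ} (γ : GL (Fin m) ℚ) : Prop :=
  ∃ N : ℕ, 0 < N ∧ IsNilpotent ((γ : Matrix (Fin m) (Fin m) ℚ) ^ N - 1)

end PeriodDomain

end

/-! A point p of the domain equips ℂ^m with a positive definite Hodge form h_p(v) = Q(C_p v, v̄).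
Along a path u(t)·base with velocity X = u⁻¹u', the Weil operator uCu⁻¹ has derivative u[X,C]u⁻¹.
The part of X that preserves the Hodge summands commutes with C, so log h(v) changes at a rate of at
most twice the Hodge norm of X (`norm_dotProduct_commutator_le`). Along a path of length ℓ, the
initial value of h(v) is therefore at most exp(2ℓ/c) times the final one (`energy_le`).

Let γv = zv and let the path join p to γp. If ν is the multiplier of γ, then |z|² h_{γp}(v) =
h_{γp}(γv) = ν h_p(v), and ν = 1 because det γ = ±1. Hence |z| ≤ exp(ℓ/c) for every eigenvalue z
(`norm_eigenvalue_le`).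

A power of γ is integral, so its eigenvalues are algebraic integers of degree at most n, whose
conjugates are again eigenvalues. For small ℓ/c their Mahler measures are close to 1. Northcott
finiteness leaves a gap above 1 that depends only on n, so the measures equal 1, and by Kronecker
the eigenvalues are roots of unity (`exists_pow_eq_one_of_norm_conjugates_le`). Then γ is
quasi-unipotent. -/

/-! ### Mahler measures and Kronecker's theorem -/

open Polynomial in
/-- Among the integer polynomials of degree at most `n`, the Mahler measures exceeding `1` are
bounded away from `1`. -/
theorem Polynomial.exists_mahlerMeasure_gap (n : ℕ) :
    ∃ B : ℝ, 1 < B ∧ ∀ f : ℤ[X], f.natDegree ≤ n →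
      (f.map (Int.castRingHom ℂ)).mahlerMeasure < B →
      (f.map (Int.castRingHom ℂ)).mahlerMeasure ≤ 1 := by
  -- Northcott finiteness; any cutoff above 1 would serve in place of 2. `B` is taken below the
  -- cutoff and below the finitely many measures in between.
  have hfin := Polynomial.finite_mahlerMeasure_le n 2
  set T : Set ℝ := (fun f : ℤ[X] => (f.map (Int.castRingHom ℂ)).mahlerMeasure) ''
    {f : ℤ[X] | f.natDegree ≤ n ∧ (f.map (Int.castRingHom ℂ)).mahlerMeasure ≤ (2 : NNReal)} ∩
      Set.Ioi 1 with hT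
  have hTfin : T.Finite := (hfin.image _).inter_of_left _
  have hopen : ∀ᶠ B in nhdsWithin (1 : ℝ) (Set.Ioi 1), B < 2 ∧ ∀ x ∈ T, B < x := by
    refine Filter.Eventually.and ?_ ?_
    · exact nhdsWithin_le_nhds (Iio_mem_nhds (by norm_num))
    · rw [Filter.eventually_all_finite hTfin]
      exact fun x hx => nhdsWithin_le_nhds (Iio_mem_nhds hx.2)
  obtain ⟨B, ⟨hB2, hB⟩, hB1⟩ := (hopen.and self_mem_nhdsWithin).exists
  refine ⟨B, hB1, fun f hf hfB => ?_⟩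
  by_contra! h
  have := hB _ ⟨⟨f, ⟨hf, by simpa using (hfB.trans hB2).le⟩, rfl⟩, h⟩
  exact absurd hfB this.not_gt

open Polynomial in
/-- A quantitative form of Kronecker's theorem: a nonzero algebraic integer of degree at most `n`
whose conjugates all have absolute value at most `R`, with `R ^ n` close enough to `1`, is a root
of unity. -/
theorem exists_pow_eq_one_of_norm_conjugates_le (n : ℕ) :
    ∃ B : ℝ, 1 < B ∧ ∀ (z : ℂ) (R : ℝ), IsIntegral ℤ z → z ≠ 0 →
      (minpoly ℚ z).natDegree ≤ n → 1 ≤ R → R ^ n < B →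
      (∀ y : ℂ, aeval y (minpoly ℚ z) = 0 → ‖y‖ ≤ R) → ∃ N : ℕ, 0 < N ∧ z ^ N = 1 := by
  obtain ⟨B, hB1, hB⟩ := Polynomial.exists_mahlerMeasure_gap n
  refine ⟨B, hB1, fun z R hz hz0 hdeg hR hRB hroots => ?_⟩
  have hmin : minpoly ℚ z = (minpoly ℤ z).map (algebraMap ℤ ℚ) :=
    minpoly.isIntegrallyClosed_eq_field_fractions' ℚ hz
  have hmonic : (minpoly ℤ z).Monic := minpoly.monic hz
  set f := minpoly ℤ z with hf
  have hdeg' : f.natDegree ≤ n := by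
    rwa [hmin, hmonic.natDegree_map] at hdeg
  have hmono' : (f.map (Int.castRingHom ℂ)).Monic := hmonic.map _
  -- `f` is monic, so its measure is a product of at most `n` factors max(1, |y|) ≤ R.
  have hM : (f.map (Int.castRingHom ℂ)).mahlerMeasure ≤ R ^ n := by
    rw [mahlerMeasure_eq_leadingCoeff_mul_prod_roots, hmono'.leadingCoeff, norm_one, one_mul]
    calc _ ≤ R ^ Multiset.card ((f.map (Int.castRingHom ℂ)).roots.map fun a => max 1 ‖a‖) := by
          rw [Multiset.card_map, ← Multiset.prod_replicate, ← Multiset.map_const']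
          refine Multiset.prod_map_le_prod_map₀ _ _ (fun y _ => by positivity) fun y hy => ?_
          refine max_le hR (hroots y ?_)
          have := (mem_roots'.1 hy).2
          rw [hmin, aeval_map_algebraMap, aeval_def, ← eval_map]
          exact this
      _ ≤ R ^ n := by
          refine pow_le_pow_right₀ hR ?_
          rw [Multiset.card_map]
          exact (card_roots' _).trans ((natDegree_map_le).trans hdeg')
  have hM1 : (f.map (Int.castRingHom ℂ)).mahlerMeasure = 1 :=
    le_antisymm (hB f hdeg' (hM.trans_lt hRB)) (one_le_mahlerMeasure_of_ne_zero hmonic.ne_zero)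
  refine pow_eq_one_of_mahlerMeasure_eq_one hM1 hz0 ?_
  rw [mem_aroots]
  exact ⟨hmonic.ne_zero, minpoly.aeval ℤ z⟩

/-! ### Eigenvalues of rational matrices -/

/-- A root of the characteristic polynomial is an eigenvalue. -/
theorem Matrix.exists_mulVec_eq_smul_of_isRoot_charpoly {K : Type*} [Field K] {m : ℕ}
    {A : Matrix (Fin m) (Fin m) K} {z : K} (hz : A.charpoly.IsRoot z) :
    ∃ v, v ≠ 0 ∧ A *ᵥ v = z • v := by
  rw [Polynomial.IsRoot.def, Matrix.eval_charpoly] at hz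
  obtain ⟨v, hv, h⟩ := Matrix.exists_mulVec_eq_zero_iff.2 hz
  refine ⟨v, hv, ?_⟩
  rw [Matrix.sub_mulVec, sub_eq_zero] at h
  rw [← h, Matrix.scalar_apply, ← Matrix.smul_one_eq_diagonal, Matrix.smul_mulVec,
    Matrix.one_mulVec]

theorem Matrix.aeval_mulVec_of_mulVec_eq_smul {K : Type*} [Field K] {m : ℕ}
    {A : Matrix (Fin m) (Fin m) K} {z : K} {v : Fin m → K} (h : A *ᵥ v = z • v)
    (f : Polynomial K) : (Polynomial.aeval A f) *ᵥ v = (f.eval z) • v := by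
  have hpow : ∀ k : ℕ, (A ^ k) *ᵥ v = z ^ k • v := by
    intro k
    induction k with
    | zero => simp
    | succ k ih =>
      rw [pow_succ, ← Matrix.mulVec_mulVec, h, Matrix.mulVec_smul, ih, smul_smul, pow_succ']
  induction f using Polynomial.induction_on' with
  | add p q hp hq => rw [map_add, Matrix.add_mulVec, hp, hq, Polynomial.eval_add, add_smul]
  | monomial k a =>
    rw [Polynomial.aeval_monomial, Polynomial.eval_monomial, ← Matrix.mulVec_mulVec, hpow,
      Matrix.algebraMap_eq_diagonal, ← smul_smul]
    ext i
    simp [Matrix.mulVec_diagonal]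

/-- The eigenvalues of a matrix over `ℚ`, a positive power of which is integral, are algebraic
integers. -/
theorem Matrix.isIntegral_of_isRoot_charpoly_of_pow_eq {m : ℕ} {A : Matrix (Fin m) (Fin m) ℚ}
    {N : ℕ} (hN : 0 < N) {M : Matrix (Fin m) (Fin m) ℤ} (hM : A ^ N = M.map (algebraMap ℤ ℚ))
    {z : ℂ} (hz : (A.map (algebraMap ℚ ℂ)).charpoly.IsRoot z) : IsIntegral ℤ z := by
  obtain ⟨v, hv, h⟩ := Matrix.exists_mulVec_eq_smul_of_isRoot_charpoly hz
  have hpow : (A.map (algebraMap ℚ ℂ)) ^ N = M.map (algebraMap ℤ ℂ) := by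
    have : (A.map (algebraMap ℚ ℂ)) ^ N = (A ^ N).map (algebraMap ℚ ℂ) :=
      (map_pow (algebraMap ℚ ℂ).mapMatrix A N).symm
    rw [this, hM, Matrix.map_map]
    congr 1
  have hN' : (M.map (algebraMap ℤ ℂ)) *ᵥ v = (z ^ N) • v := by
    have := Matrix.aeval_mulVec_of_mulVec_eq_smul h (Polynomial.X ^ N)
    rwa [map_pow, Polynomial.aeval_X, hpow, Polynomial.eval_pow, Polynomial.eval_X] at this
  -- By Cayley–Hamilton the eigenvalue z^N of the integral matrix `M` is a root of a monic integral
  -- polynomial, and integrality passes from z^N to z.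
  refine IsIntegral.of_pow hN ⟨M.charpoly, M.charpoly_monic, ?_⟩
  have h0 := Matrix.aeval_mulVec_of_mulVec_eq_smul hN' (M.map (algebraMap ℤ ℂ)).charpoly
  rw [Matrix.aeval_self_charpoly, Matrix.zero_mulVec, eq_comm, smul_eq_zero_iff_left hv] at h0
  have h1 : (M.map (algebraMap ℤ ℂ)).charpoly = M.charpoly.map (algebraMap ℤ ℂ) :=
    Matrix.charpoly_map M (algebraMap ℤ ℂ)
  rwa [h1, Polynomial.eval_map] at h0

open Polynomial in
/-- A rational matrix all of whose eigenvalues are roots of unity has a positive power that is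
unipotent. -/
theorem Matrix.exists_isNilpotent_pow_sub_one {m : ℕ} (A : Matrix (Fin m) (Fin m) ℚ)
    (h : ∀ z : ℂ, (A.map (algebraMap ℚ ℂ)).charpoly.IsRoot z → ∃ N : ℕ, 0 < N ∧ z ^ N = 1) :
    ∃ N : ℕ, 0 < N ∧ IsNilpotent (A ^ N - 1) := by
  set p := (A.map (algebraMap ℚ ℂ)).charpoly with hp
  have hmonic : p.Monic := Matrix.charpoly_monic _
  choose! e he0 he using h
  set N := ∏ z ∈ p.roots.toFinset, e z with hN
  have hmem : ∀ z ∈ p.roots, p.IsRoot z := fun z hz => (mem_roots'.1 hz).2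
  have hN0 : 0 < N := Finset.prod_pos fun z hz => he0 z (hmem z (Multiset.mem_toFinset.1 hz))
  have hone : ∀ z ∈ p.roots, z ^ N = 1 := by
    intro z hz
    obtain ⟨k, hk⟩ := Finset.dvd_prod_of_mem e (Multiset.mem_toFinset.2 hz)
    rw [hN, hk, pow_mul, he z (hmem z hz), one_pow]
  -- Each linear factor of `p` divides X^N − 1. The exponent counts the factors with multiplicity,
  -- so Cayley–Hamilton then gives nilpotency.
  have hdvd : p ∣ (X ^ N - 1) ^ Multiset.card p.roots := by
    have hsp := (IsAlgClosed.splits p).eq_prod_roots_of_monic hmonic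
    conv_lhs => rw [hsp]
    rw [← Multiset.prod_replicate, ← Multiset.map_const']
    refine Multiset.prod_dvd_prod_of_dvd _ _ fun z hz => ?_
    rw [dvd_iff_isRoot, IsRoot.def]
    simp [hone z hz]
  obtain ⟨q, hq⟩ := hdvd
  refine ⟨N, hN0, Multiset.card p.roots, ?_⟩
  have hC : ((A.map (algebraMap ℚ ℂ)) ^ N - 1) ^ Multiset.card p.roots = 0 := by
    have := congrArg (aeval (A.map (algebraMap ℚ ℂ))) hq
    rw [map_mul, hp, Matrix.aeval_self_charpoly, zero_mul] at this
    simpa using this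
  have hinj : Function.Injective ((algebraMap ℚ ℂ).mapMatrix (m := Fin m)) :=
    Matrix.map_injective (algebraMap ℚ ℂ).injective
  refine hinj ?_
  rw [map_pow, map_sub, map_pow, map_one, map_zero]
  exact hC

/-! ### A Hilbert–Schmidt inequality -/

open scoped MatrixOrder ComplexOrder in
/-- For a positive definite `S`, the quadratic form of `S * X` is bounded by that of `S` times the
Hilbert-Schmidt norm of `X` with respect to `S`. -/
theorem Matrix.PosDef.norm_dotProduct_mul_mulVec_le {m : ℕ} {S : Matrix (Fin m) (Fin m) ℂ}
    (hS : S.PosDef) (X : Matrix (Fin m) (Fin m) ℂ) (x : Fin m → ℂ) :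
    ‖star x ⬝ᵥ (S * X) *ᵥ x‖ ≤
      √((X * (S⁻¹ * Xᴴ * S)).trace.re) * (star x ⬝ᵥ S *ᵥ x).re := by
  -- Factoring S = BᴴB and conjugating `X` by `B` reduces to the standard inner product, where the
  -- bound is Cauchy–Schwarz over pairs of indices.
  obtain ⟨B, hB, hSB⟩ := CStarAlgebra.isStrictlyPositive_iff_eq_star_mul_self.mp
    hS.isStrictlyPositive
  rw [Matrix.star_eq_conjTranspose] at hSB
  have hBdet : IsUnit B.det := (Matrix.isUnit_iff_isUnit_det B).1 hB
  have hBdet' : IsUnit Bᴴ.det := by rw [Matrix.det_conjTranspose]; exact hBdet.star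
  set Y := B * X * B⁻¹ with hY
  set y := B *ᵥ x with hy
  have hyx : ∀ z, star x ⬝ᵥ Bᴴ *ᵥ z = star y ⬝ᵥ z := by
    intro z
    rw [hy, Matrix.star_mulVec, ← Matrix.dotProduct_mulVec]
  have h1 : star x ⬝ᵥ (S * X) *ᵥ x = star y ⬝ᵥ Y *ᵥ y := by
    rw [hSB, Matrix.mul_assoc, ← Matrix.mulVec_mulVec, hyx, hY, hy, Matrix.mulVec_mulVec,
      Matrix.nonsing_inv_mul_cancel_right B _ hBdet]
  have h2 : star x ⬝ᵥ S *ᵥ x = star y ⬝ᵥ y := by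
    rw [hSB, ← Matrix.mulVec_mulVec, hyx]
  have h3 : (X * (S⁻¹ * Xᴴ * S)).trace = (Y * Yᴴ).trace := by
    have e1 : X * (S⁻¹ * Xᴴ * S) = (X * B⁻¹ * (Bᴴ)⁻¹ * Xᴴ * Bᴴ) * B := by
      rw [hSB, Matrix.mul_inv_rev]; simp only [Matrix.mul_assoc]
    have e2 : Y * Yᴴ = B * (X * B⁻¹ * (Bᴴ)⁻¹ * Xᴴ * Bᴴ) := by
      rw [hY, Matrix.conjTranspose_mul, Matrix.conjTranspose_mul, Matrix.conjTranspose_nonsing_inv]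
      simp only [Matrix.mul_assoc]
    rw [e1, e2, Matrix.trace_mul_comm]
  have h4 : (star y ⬝ᵥ y).re = ∑ i, ‖y i‖ ^ 2 := by
    simp [dotProduct, Complex.sq_norm, Complex.normSq_apply]
  have h5 : (Y * Yᴴ).trace.re = ∑ ij : Fin m × Fin m, ‖Y ij.1 ij.2‖ ^ 2 := by
    rw [Fintype.sum_prod_type]
    simp [Matrix.trace, Matrix.mul_apply, Complex.sq_norm, Complex.normSq_apply]
  rw [h1, h2, h3, h4, h5]
  have h6 : star y ⬝ᵥ Y *ᵥ y = ∑ ij : Fin m × Fin m, Y ij.1 ij.2 * (star (y ij.1) * y ij.2) := by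
    rw [Fintype.sum_prod_type]
    simp only [dotProduct, Matrix.mulVec, Finset.mul_sum, Pi.star_apply]
    exact Finset.sum_congr rfl fun i _ => Finset.sum_congr rfl fun j _ => by ring
  have h7 : ∑ ij : Fin m × Fin m, (‖y ij.1‖ * ‖y ij.2‖) ^ 2 = (∑ i, ‖y i‖ ^ 2) ^ 2 := by
    rw [Fintype.sum_prod_type, sq (∑ i, ‖y i‖ ^ 2), Finset.sum_mul_sum]
    simp only [mul_pow]
  rw [h6]
  calc _ ≤ ∑ ij : Fin m × Fin m, ‖Y ij.1 ij.2‖ * (‖y ij.1‖ * ‖y ij.2‖) := by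
        refine (norm_sum_le _ _).trans (Finset.sum_le_sum fun ij _ => ?_)
        rw [norm_mul, norm_mul, norm_star]
    _ ≤ √(∑ ij : Fin m × Fin m, ‖Y ij.1 ij.2‖ ^ 2) *
          √(∑ ij : Fin m × Fin m, (‖y ij.1‖ * ‖y ij.2‖) ^ 2) :=
        Real.sum_mul_le_sqrt_mul_sqrt _ _ _
    _ = _ := by rw [h7, Real.sqrt_sq (Finset.sum_nonneg fun i _ => by positivity)]

/-! ### The Weil operator and the Hodge form -/

namespace PeriodDomain

/-- The complexification of an integral matrix. -/
abbrev intCplx {m : ℕ} (Q : Matrix (Fin m) (Fin m) ℤ) : Matrix (Fin m) (Fin m) ℂ :=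
  Q.map (Int.cast : ℤ → ℂ)

theorem conjM_mul {m : ℕ} (A B : Matrix (Fin m) (Fin m) ℂ) : conjM (A * B) = conjM A * conjM B :=
  Matrix.map_mul

theorem star_mulVec_eq_conjM_mulVec {m : ℕ} (A : Matrix (Fin m) (Fin m) ℂ) (x : Fin m → ℂ) :
    star (A *ᵥ x) = conjM A *ᵥ star x := by
  ext i
  simp [conjM, Matrix.mulVec, dotProduct]

theorem conjM_intCplx {m : ℕ} (Q : Matrix (Fin m) (Fin m) ℤ) : conjM (intCplx Q) = intCplx Q := by
  ext i j
  simp [conjM]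

namespace HodgeStructure

variable {m : ℕ} {k : ℤ} (h : HodgeStructure m k) {Q : Matrix (Fin m) (Fin m) ℤ}

theorem weil_mul_proj (p : ℤ) : h.weil * h.proj p = Complex.I ^ (p - (k - p)) • h.proj p := by
  rw [weil, Finsupp.sum, Finset.sum_mul, Finset.sum_eq_single p]
  · rw [Matrix.smul_mul, h.proj_idem]
  · intro q _ hq
    rw [Matrix.smul_mul, h.proj_orth q p hq, smul_zero]
  · intro hp
    simp [Finsupp.notMem_support_iff.1 hp]

theorem proj_mul_weil (p : ℤ) : h.proj p * h.weil = Complex.I ^ (p - (k - p)) • h.proj p := by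
  rw [weil, Finsupp.sum, Finset.mul_sum, Finset.sum_eq_single p]
  · rw [Matrix.mul_smul, h.proj_idem]
  · intro q _ hq
    rw [Matrix.mul_smul, h.proj_orth p q hq.symm, smul_zero]
  · intro hp
    simp [Finsupp.notMem_support_iff.1 hp]

theorem sum_proj : ∑ p ∈ h.proj.support, h.proj p = 1 := h.proj_sum

/-- A matrix is determined by its products with the Hodge projectors on the right. -/
theorem eq_of_forall_mul_proj {A B : Matrix (Fin m) (Fin m) ℂ}
    (hAB : ∀ p, A * h.proj p = B * h.proj p) : A = B := by
  rw [← Matrix.mul_one A, ← Matrix.mul_one B, ← h.sum_proj, Finset.mul_sum, Finset.mul_sum]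
  exact Finset.sum_congr rfl fun p _ => hAB p

/-- A bilinear form is determined by its restrictions to the pairs of Hodge summands. -/
theorem eq_of_forall_proj_mul_proj {A B : Matrix (Fin m) (Fin m) ℂ}
    (hAB : ∀ p q, (h.proj p)ᵀ * A * h.proj q = (h.proj p)ᵀ * B * h.proj q) : A = B := by
  refine Matrix.transpose_injective (h.eq_of_forall_mul_proj fun p =>
    Matrix.transpose_injective ?_)
  refine h.eq_of_forall_mul_proj fun q => ?_
  simpa [Matrix.transpose_mul] using hAB p q

/-- Conjugation exchanges V^{p,q} and V^{q,p}, and the conjugate of i^{q-p} is i^{p-q}. -/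
theorem conjM_weil : conjM h.weil = h.weil := by
  refine h.eq_of_forall_mul_proj fun p => ?_
  have h1 : h.proj p = conjM (h.proj (k - p)) := by rw [h.proj_conj, sub_sub_cancel]
  rw [h.weil_mul_proj, h1, ← conjM_mul, h.weil_mul_proj]
  ext i j
  have hI : (starRingEnd ℂ) (Complex.I ^ (k - p - (k - (k - p)))) = Complex.I ^ (p - (k - p)) := by
    rw [map_zpow₀, Complex.conj_I, ← Complex.inv_I, _root_.inv_zpow', show
      -(k - p - (k - (k - p))) = p - (k - p) by ring]
  simp only [conjM, Matrix.map_apply, Matrix.smul_apply, smul_eq_mul, map_mul, hI]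

theorem weil_act (g : GL (Fin m) ℝ) : (act g h).weil =
    (toC g : Matrix (Fin m) (Fin m) ℂ) * h.weil * ((toC g)⁻¹ : GL (Fin m) ℂ) := by
  rw [weil, act, Finsupp.sum_mapRange_index (by simp), weil]
  simp only [Finsupp.sum, Finset.mul_sum, Finset.sum_mul, Matrix.mul_smul, Matrix.smul_mul]

/-- On V^{p,q} the square is (-1)^{p-q}, and p − q = 2p − k has the parity of k. -/
theorem weil_mul_weil : h.weil * h.weil = ((k.negOnePow : ℤ) : ℂ) • 1 := by
  refine h.eq_of_forall_mul_proj fun p => ?_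
  rw [Matrix.mul_assoc, h.weil_mul_proj, Matrix.mul_smul, h.weil_mul_proj, smul_smul,
    Matrix.smul_mul, Matrix.one_mul]
  congr 1
  rw [← mul_zpow, Complex.I_mul_I]
  have hcast : ((k.negOnePow : ℤ) : ℂ) = (-1 : ℂ) ^ k := by
    rw [Int.cast_negOnePow]
  rw [hcast, show p - (k - p) = 2 * p - k by ring, zpow_sub₀ (by norm_num), _root_.zpow_mul]
  norm_num
  rw [← _root_.inv_zpow]
  norm_num

namespace IsPolarizedBy

variable {h}

theorem proj_mul_mul_proj_eq_zero (hQ : h.IsPolarizedBy Q) {p q : ℤ} (hpq : p + q ≠ k) :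
    (h.proj p)ᵀ * intCplx Q * h.proj q = 0 := by
  ext i j
  have := hQ.orth p q hpq _ ⟨Pi.single i 1, rfl⟩ _ ⟨Pi.single j 1, rfl⟩
  simp only [Matrix.mulVecLin_apply, Matrix.mulVec_single_one] at this
  rw [Matrix.mul_assoc, Matrix.mul_apply, Matrix.zero_apply, ← this]
  simp only [dotProduct, Matrix.mulVec, Matrix.mul_apply, Matrix.transpose_apply, Matrix.col]

/-- The Weil operator is an isometry of the polarization. -/
theorem weil_isometry (hQ : h.IsPolarizedBy Q) : h.weilᵀ * intCplx Q * h.weil = intCplx Q := by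
  refine h.eq_of_forall_proj_mul_proj fun p q => ?_
  have e : (h.proj p)ᵀ * (h.weilᵀ * intCplx Q * h.weil) * h.proj q =
      (h.weil * h.proj p)ᵀ * intCplx Q * (h.weil * h.proj q) := by
    rw [Matrix.transpose_mul]; simp only [Matrix.mul_assoc]
  rw [e, h.weil_mul_proj, h.weil_mul_proj, Matrix.transpose_smul, Matrix.smul_mul, Matrix.smul_mul,
    Matrix.mul_smul, smul_smul]
  -- Only complementary summands pair nontrivially under Q, and for these the two powers of i
  -- cancel.
  by_cases hpq : p + q = k
  · obtain rfl : q = k - p := by omega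
    rw [← zpow_add₀ Complex.I_ne_zero,
      show p - (k - p) + (k - p - (k - (k - p))) = 0 by ring, zpow_zero, one_smul]
  · rw [hQ.proj_mul_mul_proj_eq_zero hpq, smul_zero]

/-- Two signs cancel: (CᵀQ)ᵀ = (-1)^k QC = (-1)^k CᵀQC² = CᵀQ, using that C is an isometry of Q with
C² = (-1)^k. -/
theorem gram_transpose (hQ : h.IsPolarizedBy Q) : (h.gram Q)ᵀ = h.gram Q := by
  have hsymm : (intCplx Q)ᵀ = ((k.negOnePow : ℤ) : ℂ) • intCplx Q := by
    ext i j
    have := congrFun (congrFun hQ.symm i) j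
    simp only [Matrix.transpose_apply, Matrix.smul_apply, smul_eq_mul] at this
    simp only [Matrix.transpose_apply, Matrix.map_apply, Matrix.smul_apply, smul_eq_mul, this,
      Int.cast_mul]
  change (h.weilᵀ * intCplx Q)ᵀ = h.weilᵀ * intCplx Q
  rw [Matrix.transpose_mul, Matrix.transpose_transpose, hsymm]
  conv_lhs => rw [← hQ.weil_isometry]
  rw [Matrix.smul_mul, Matrix.mul_assoc _ h.weil, h.weil_mul_weil, Matrix.mul_smul, Matrix.mul_one,
    smul_smul]
  have : ((k.negOnePow : ℤ) : ℂ) * ((k.negOnePow : ℤ) : ℂ) = 1 := by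
    rw [← Int.cast_mul, ← Units.val_mul]
    simp
  rw [this, one_smul]

theorem conjM_gram : conjM (h.gram Q) = h.gram Q := by
  change conjM (h.weilᵀ * intCplx Q) = h.weilᵀ * intCplx Q
  have : conjM h.weilᵀ = h.weilᵀ := by
    conv_rhs => rw [← h.conjM_weil]
    rfl
  rw [conjM_mul, this, conjM_intCplx]

theorem isHermitian_gram (hQ : h.IsPolarizedBy Q) : (h.gram Q).IsHermitian := by
  have : (h.gram Q)ᴴ = (conjM (h.gram Q))ᵀ := rfl
  rw [Matrix.IsHermitian, this, conjM_gram, hQ.gram_transpose]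

/-- Pairing with V^{p,k-p} sees only the V^{k-p,p} component, so one of the two projectors in Q(P_p
x, conj(P_p x)) can be dropped. -/
theorem proj_mul_eq (hQ : h.IsPolarizedBy Q) (p : ℤ) :
    (h.proj p)ᵀ * intCplx Q = (h.proj p)ᵀ * intCplx Q * h.proj (k - p) := by
  refine h.eq_of_forall_mul_proj fun q => ?_
  by_cases hq : k - p = q
  · subst hq
    rw [Matrix.mul_assoc _ (h.proj (k - p)), h.proj_idem]
  · rw [hQ.proj_mul_mul_proj_eq_zero (by omega), Matrix.mul_assoc _ (h.proj (k - p)),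
      h.proj_orth _ _ hq, Matrix.mul_zero]

/-- The Hodge decomposition is orthogonal for the Hodge form, and each summand is a quantity whose
positivity the polarization asserts. -/
theorem dotProduct_gram_mulVec (hQ : h.IsPolarizedBy Q) (x : Fin m → ℂ) :
    x ⬝ᵥ h.gram Q *ᵥ star x = ∑ p ∈ h.proj.support, Complex.I ^ (p - (k - p)) *
      ((h.proj p *ᵥ x) ⬝ᵥ intCplx Q *ᵥ star (h.proj p *ᵥ x)) := by
  have h1 : ∀ p, (h.proj p *ᵥ x) ⬝ᵥ intCplx Q *ᵥ star (h.proj p *ᵥ x) =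
      x ⬝ᵥ ((h.proj p)ᵀ * intCplx Q) *ᵥ star x := by
    intro p
    rw [star_mulVec_eq_conjM_mulVec, h.proj_conj, hQ.proj_mul_eq, Matrix.mulVec_mulVec,
      Matrix.mul_assoc, ← Matrix.mulVec_mulVec _ (h.proj p)ᵀ, Matrix.dotProduct_mulVec x,
      Matrix.vecMul_transpose]
  have h2 : h.gram Q = ∑ p ∈ h.proj.support,
      Complex.I ^ (p - (k - p)) • ((h.proj p)ᵀ * intCplx Q) := by
    rw [gram, weil, Finsupp.sum, Matrix.transpose_sum, Finset.sum_mul]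
    simp only [Matrix.transpose_smul, Matrix.smul_mul]
  rw [h2, Matrix.sum_mulVec, dotProduct_sum]
  refine Finset.sum_congr rfl fun p _ => ?_
  rw [h1, Matrix.smul_mulVec, dotProduct_smul, smul_eq_mul]

theorem re_dotProduct_gram_mulVec_pos (hQ : h.IsPolarizedBy Q) {x : Fin m → ℂ} (hx : x ≠ 0) :
    0 < (star x ⬝ᵥ h.gram Q *ᵥ x).re := by
  have hx' : star x ≠ 0 := by simpa using hx
  have := hQ.dotProduct_gram_mulVec (star x)
  rw [star_star] at this
  rw [this, Complex.re_sum]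
  have hmem : ∀ p, h.proj p *ᵥ star x ∈ h.piece p := fun p => ⟨star x, rfl⟩
  have hnn : ∀ p, 0 ≤ (Complex.I ^ (p - (k - p)) *
      ((h.proj p *ᵥ star x) ⬝ᵥ intCplx Q *ᵥ star (h.proj p *ᵥ star x))).re := by
    intro p
    by_cases hp : h.proj p *ᵥ star x = 0
    · simp [hp]
    · exact (hQ.pos p _ (hmem p) hp).le
  refine Finset.sum_pos' (fun p _ => hnn p) ?_
  by_contra! hall
  apply hx'
  rw [← Matrix.one_mulVec (star x), ← h.sum_proj, Matrix.sum_mulVec]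
  refine Finset.sum_eq_zero fun p hp => ?_
  by_contra hne
  exact absurd (hQ.pos p _ (hmem p) hne) (hall p hp).not_gt

open scoped ComplexOrder in
theorem posDef_gram (hQ : h.IsPolarizedBy Q) : (h.gram Q).PosDef := by
  refine .of_dotProduct_mulVec_pos hQ.isHermitian_gram fun x hx => ?_
  rw [Complex.pos_iff]
  refine ⟨hQ.re_dotProduct_gram_mulVec_pos hx, ?_⟩
  exact (hQ.isHermitian_gram.im_star_dotProduct_mulVec_self x).symm

theorem dotProduct_gram_mulVec_star (hQ : h.IsPolarizedBy Q) (x : Fin m → ℂ) :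
    x ⬝ᵥ h.gram Q *ᵥ star x = star x ⬝ᵥ h.gram Q *ᵥ x := by
  rw [Matrix.dotProduct_mulVec, ← Matrix.mulVec_transpose, hQ.gram_transpose, dotProduct_comm]

/-- A kernel vector of Q would have Hodge norm zero. -/
theorem det_intCplx_ne_zero (hQ : h.IsPolarizedBy Q) : (intCplx Q).det ≠ 0 := by
  intro hdet
  obtain ⟨v, hv, hv0⟩ := Matrix.exists_mulVec_eq_zero_iff.2 hdet
  have := hQ.re_dotProduct_gram_mulVec_pos hv
  rw [gram, ← Matrix.mulVec_mulVec] at this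
  rw [hv0] at this
  simp at this

/-- The derivative of the Gram matrix along `X` is controlled by the Hodge norm of `X`. -/
theorem norm_dotProduct_commutator_le (hQ : h.IsPolarizedBy Q) (X : Matrix (Fin m) (Fin m) ℝ)
    (w : Fin m → ℂ) :
    ‖star w ⬝ᵥ ((cplx X * h.weil - h.weil * cplx X)ᵀ * intCplx Q) *ᵥ w‖ ≤
      2 * √(h.hodgeSq Q X) * (star w ⬝ᵥ h.gram Q *ᵥ w).re := by
  set X' := h.offDiag X with hX'
  set C := h.weil with hC
  set S := h.gram Q with hS
  have hSC : S = Cᵀ * intCplx Q := rfl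
  -- `C` is scalar on each summand, so the block-diagonal part of `X` commutes with it.
  have hcomm : cplx X * C - C * cplx X = X' * C - C * X' := by
    have hD : (h.proj.sum fun _ P => P * cplx X * P) * C =
        C * (h.proj.sum fun _ P => P * cplx X * P) := by
      simp only [Finsupp.sum, Finset.sum_mul, Finset.mul_sum]
      refine Finset.sum_congr rfl fun p _ => ?_
      rw [Matrix.mul_assoc, hC, h.proj_mul_weil, ← Matrix.mul_assoc, ← Matrix.mul_assoc,
        h.weil_mul_proj]
      simp only [Matrix.mul_smul, Matrix.smul_mul]
    rw [hX', offDiag, Matrix.sub_mul, Matrix.mul_sub, hD]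
    abel
  have key : ∀ y : Fin m → ℂ, ‖y ⬝ᵥ (X'ᵀ * S) *ᵥ star y‖ ≤
      √(h.hodgeSq Q X) * (star y ⬝ᵥ S *ᵥ y).re := by
    intro y
    have : y ⬝ᵥ (X'ᵀ * S) *ᵥ star y = star y ⬝ᵥ (S * X') *ᵥ y := by
      rw [Matrix.dotProduct_mulVec, ← Matrix.mulVec_transpose, Matrix.transpose_mul,
        Matrix.transpose_transpose, hQ.gram_transpose, dotProduct_comm]
    rw [this]
    exact hQ.posDef_gram.norm_dotProduct_mul_mulVec_le X' y
  set x := star w with hx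
  have hw : w = star x := by rw [hx, star_star]
  have hSx : (x ⬝ᵥ S *ᵥ w).re = (star x ⬝ᵥ S *ᵥ x).re := by
    rw [hw, hQ.dotProduct_gram_mulVec_star]
  have hSCC : Cᵀ * S * C = S := by
    rw [hSC, Matrix.mul_assoc, hC, hQ.weil_isometry]
  have hCx : star (C *ᵥ x) = C *ᵥ star x := by
    rw [star_mulVec_eq_conjM_mulVec, hC, h.conjM_weil]
  -- The two terms of [X', C] are the form of X' evaluated at Cx and at x. Since `C` preserves the
  -- Hodge norm, both obey the same bound, whence the factor 2.
  have e1 : x ⬝ᵥ ((X' * C)ᵀ * intCplx Q) *ᵥ w = (C *ᵥ x) ⬝ᵥ (X'ᵀ * S) *ᵥ star (C *ᵥ x) := by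
    rw [hCx, ← hw, Matrix.mulVec_mulVec, hSC, Matrix.mul_assoc, hC, hQ.weil_isometry,
      Matrix.transpose_mul, Matrix.mul_assoc, ← Matrix.mulVec_mulVec _ h.weilᵀ,
      Matrix.dotProduct_mulVec x, Matrix.vecMul_transpose]
  have e2 : x ⬝ᵥ ((C * X')ᵀ * intCplx Q) *ᵥ w = x ⬝ᵥ (X'ᵀ * S) *ᵥ star x := by
    rw [Matrix.transpose_mul, Matrix.mul_assoc, ← hSC, ← hw]
  have e3 : star (C *ᵥ x) ⬝ᵥ S *ᵥ (C *ᵥ x) = star x ⬝ᵥ S *ᵥ x := by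
    conv_rhs => rw [← hSCC, Matrix.mul_assoc, ← Matrix.mulVec_mulVec, Matrix.dotProduct_mulVec,
      Matrix.vecMul_transpose, ← Matrix.mulVec_mulVec]
    rw [hCx]
  rw [hcomm, Matrix.transpose_sub, Matrix.sub_mul, Matrix.sub_mulVec, dotProduct_sub, e1, e2, hSx]
  refine (norm_sub_le _ _).trans ?_
  have k1 := key (C *ᵥ x)
  have k2 := key x
  rw [e3] at k1
  linarith

end IsPolarizedBy

/-- A similitude with multiplier `ν` carries the Hodge form of `h` to `ν` times that of its
translate. -/
theorem dotProduct_gram_act_mulVec (g : GL (Fin m) ℝ) {ν : ℝ}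
    (hg : (toC g : Matrix (Fin m) (Fin m) ℂ)ᵀ * intCplx Q * toC g = (ν : ℂ) • intCplx Q)
    (x : Fin m → ℂ) :
    (star ((toC g : Matrix (Fin m) (Fin m) ℂ) *ᵥ x) ⬝ᵥ
      (act g h).gram Q *ᵥ ((toC g : Matrix (Fin m) (Fin m) ℂ) *ᵥ x)).re =
      ν * (star x ⬝ᵥ h.gram Q *ᵥ x).re := by
  have hreal : conjM (toC g : Matrix (Fin m) (Fin m) ℂ) = toC g := by
    ext i j
    simp [conjM, toC]
  have e : (toC g : Matrix (Fin m) (Fin m) ℂ)ᵀ * (act g h).gram Q * toC g =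
      (ν : ℂ) • h.gram Q := by
    rw [gram, weil_act, gram, Matrix.transpose_mul, Matrix.transpose_mul]
    have : (toC g : Matrix (Fin m) (Fin m) ℂ)ᵀ *
        (((toC g)⁻¹ : GL (Fin m) ℂ) : Matrix (Fin m) (Fin m) ℂ)ᵀ = 1 := by
      rw [← Matrix.transpose_mul, Units.inv_mul, Matrix.transpose_one]
    rw [← Matrix.mul_assoc, ← Matrix.mul_assoc, this, Matrix.one_mul, Matrix.mul_assoc,
      Matrix.mul_assoc, ← Matrix.mul_assoc _ (intCplx Q), hg, Matrix.mul_smul]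
  rw [star_mulVec_eq_conjM_mulVec, hreal, ← Matrix.vecMul_transpose, ← Matrix.dotProduct_mulVec,
    Matrix.mulVec_mulVec, Matrix.mulVec_mulVec, e, Matrix.smul_mulVec,
    dotProduct_smul, smul_eq_mul, Complex.re_ofReal_mul]

end HodgeStructure

end PeriodDomain

/-! ### Multipliers of real similitudes -/

namespace PeriodDomain

theorem coe_toC {m : ℕ} (g : GL (Fin m) ℝ) :
    (toC g : Matrix (Fin m) (Fin m) ℂ) = cplx (g : Matrix (Fin m) (Fin m) ℝ) := rfl

theorem cplx_mul {m : ℕ} (A B : Matrix (Fin m) (Fin m) ℝ) : cplx (A * B) = cplx A * cplx B :=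
  Matrix.map_mul

namespace Datum

variable {m : ℕ} (𝒟 : Datum m)

/-- Both g and Q are real, so conjugating the relation shows that ν is real when Q ≠ 0;
invertibility of g excludes ν = 0. If Q = 0, any real number serves. -/
theorem exists_multiplier {g : GL (Fin m) ℝ} (hg : g ∈ 𝒟.realPoints) :
    ∃ ν : ℝ, ν ≠ 0 ∧ (toC g : Matrix (Fin m) (Fin m) ℂ)ᵀ * intCplx 𝒟.Q * toC g
      = (ν : ℂ) • intCplx 𝒟.Q := by
  by_cases hQ : intCplx 𝒟.Q = 0
  · exact ⟨1, one_ne_zero, by simp [hQ]⟩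
  obtain ⟨ν, hν⟩ := 𝒟.similitude _ hg
  change _ * intCplx 𝒟.Q * _ = ν • intCplx 𝒟.Q at hν
  have hν0 : ν ≠ 0 := by
    rintro rfl
    apply hQ
    rw [zero_smul] at hν
    have e : (((toC g)⁻¹ : GL (Fin m) ℂ) : Matrix (Fin m) (Fin m) ℂ)ᵀ *
        (toC g : Matrix (Fin m) (Fin m) ℂ)ᵀ = 1 := by
      rw [← Matrix.transpose_mul, Units.mul_inv, Matrix.transpose_one]
    calc intCplx 𝒟.Q = (((toC g)⁻¹ : GL (Fin m) ℂ) : Matrix (Fin m) (Fin m) ℂ)ᵀ *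
          ((toC g : Matrix (Fin m) (Fin m) ℂ)ᵀ * intCplx 𝒟.Q * toC g) *
          ((toC g)⁻¹ : GL (Fin m) ℂ) := by
          rw [← Matrix.mul_assoc, ← Matrix.mul_assoc, e, Matrix.one_mul, Matrix.mul_assoc,
            Units.mul_inv, Matrix.mul_one]
      _ = 0 := by rw [hν, Matrix.mul_zero, Matrix.zero_mul]
  have hconj : ν • intCplx 𝒟.Q = (starRingEnd ℂ ν) • intCplx 𝒟.Q := by
    have h1 : conjM (toC g : Matrix (Fin m) (Fin m) ℂ) = toC g := by
      ext i j
      simp [conjM, toC]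
    have h2 : conjM (toC g : Matrix (Fin m) (Fin m) ℂ)ᵀ = (toC g : Matrix (Fin m) (Fin m) ℂ)ᵀ := by
      conv_rhs => rw [← h1]
      rfl
    have h3 := congrArg conjM hν
    rw [conjM_mul, conjM_mul, h1, h2, conjM_intCplx, hν] at h3
    rw [h3]
    ext i j
    simp [conjM]
  have hreal : (ν.re : ℂ) = ν :=
    Complex.conj_eq_iff_re.1 (smul_left_injective ℂ hQ hconj).symm
  refine ⟨ν.re, fun h0 => hν0 ?_, by rw [hreal, hν]⟩
  rw [← hreal, h0, Complex.ofReal_zero]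

/-- Elements of the identity component have positive multiplier. -/
theorem exists_pos_multiplier {g : GL (Fin m) ℝ} (hg : g ∈ 𝒟.realPlus) :
    ∃ ν : ℝ, 0 < ν ∧ (toC g : Matrix (Fin m) (Fin m) ℂ)ᵀ * intCplx 𝒟.Q * toC g
      = (ν : ℂ) • intCplx 𝒟.Q := by
  by_cases hQ : ∃ i j, 𝒟.Q i j ≠ 0
  swap
  · push Not at hQ
    have : intCplx 𝒟.Q = 0 := by ext i j; simp [hQ]
    exact ⟨1, one_pos, by simp [this]⟩
  obtain ⟨i, j, hij⟩ := hQ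
  have hij' : (𝒟.Q i j : ℝ) ≠ 0 := by exact_mod_cast hij
  -- The multiplier is read off at a nonzero entry of Q. It is continuous, nowhere zero and 1 at the
  -- identity, hence positive on the identity component.
  let φ : 𝒟.realPoints → ℝ := fun x =>
    ((((x : GL (Fin m) ℝ) : Matrix (Fin m) (Fin m) ℝ)ᵀ * 𝒟.Q.map (Int.cast : ℤ → ℝ) *
      ((x : GL (Fin m) ℝ) : Matrix (Fin m) (Fin m) ℝ)) i j) / 𝒟.Q i j
  have hφ : ∀ (x : 𝒟.realPoints) (ν : ℝ),
      (toC (x : GL (Fin m) ℝ) : Matrix (Fin m) (Fin m) ℂ)ᵀ * intCplx 𝒟.Q *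
        toC (x : GL (Fin m) ℝ) = (ν : ℂ) • intCplx 𝒟.Q → φ x = ν := by
    intro x ν hν
    have h1 := congrFun (congrFun hν i) j
    have h2 : (toC (x : GL (Fin m) ℝ) : Matrix (Fin m) (Fin m) ℂ)ᵀ * intCplx 𝒟.Q *
        toC (x : GL (Fin m) ℝ) = cplx (((x : GL (Fin m) ℝ) : Matrix (Fin m) (Fin m) ℝ)ᵀ * 𝒟.Q.map (Int.cast : ℤ → ℝ) *
          ((x : GL (Fin m) ℝ) : Matrix (Fin m) (Fin m) ℝ)) := by
      rw [cplx_mul, cplx_mul]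
      congr 2
    rw [h2] at h1
    simp only [cplx, Matrix.map_apply, Matrix.smul_apply, smul_eq_mul, Complex.coe_algebraMap] at h1
    rw [div_eq_iff hij']
    exact_mod_cast h1
  have hcont : Continuous φ := by
    have : Continuous fun x : 𝒟.realPoints =>
        ((x : GL (Fin m) ℝ) : Matrix (Fin m) (Fin m) ℝ) :=
      Units.continuous_val.comp continuous_subtype_val
    refine Continuous.div_const ?_ _
    exact ((this.matrix_transpose.matrix_mul continuous_const).matrix_mul this).matrix_elem i j
  have hne : ∀ x, φ x ≠ 0 := by
    intro x
    obtain ⟨ν, hν0, hν⟩ := 𝒟.exists_multiplier x.2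
    rw [hφ x ν hν]
    exact hν0
  have hone : φ 1 = 1 := hφ 1 1 (by simp)
  obtain ⟨x, hx, rfl⟩ := hg
  have hx' : x ∈ connectedComponent (1 : 𝒟.realPoints) := hx
  obtain ⟨ν, hν0, hν⟩ := 𝒟.exists_multiplier x.2
  refine ⟨ν, ?_, hν⟩
  by_contra! hneg
  have hpre : IsPreconnected (φ '' connectedComponent (1 : 𝒟.realPoints)) :=
    isPreconnected_connectedComponent.image φ hcont.continuousOn
  have := hpre.Icc_subset ⟨x, hx', rfl⟩ ⟨1, mem_connectedComponent, rfl⟩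
    (show (0 : ℝ) ∈ Set.Icc (φ x) (φ 1) from ⟨by rw [hφ x ν hν]; exact hneg, by rw [hone]; simp⟩)
  obtain ⟨y, -, hy⟩ := this
  exact hne y hy

variable {𝒟}

/-- Take determinants and cancel det Q. This forces a nonnegative multiplier to be 1 when det g = ±1
and m > 0. -/
theorem multiplier_pow_eq_det_sq {g : GL (Fin m) ℝ} {ν : ℝ}
    (hg : (toC g : Matrix (Fin m) (Fin m) ℂ)ᵀ * intCplx 𝒟.Q * toC g = (ν : ℂ) • intCplx 𝒟.Q) :
    ν ^ m = (g : Matrix (Fin m) (Fin m) ℝ).det ^ 2 := by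
  have h1 := congrArg Matrix.det hg
  have h0 := 𝒟.polarized.det_intCplx_ne_zero
  have h2 : (toC g : Matrix (Fin m) (Fin m) ℂ).det =
      (((g : Matrix (Fin m) (Fin m) ℝ).det : ℝ) : ℂ) :=
    (RingHom.map_det (algebraMap ℝ ℂ) (g : Matrix (Fin m) (Fin m) ℝ)).symm
  rw [Matrix.det_mul, Matrix.det_mul, Matrix.det_transpose, Matrix.det_smul, Fintype.card_fin,
    h2, mul_right_comm] at h1
  have h3 := mul_right_cancel₀ h0 h1
  rw [sq]
  exact_mod_cast h3.symm

/-! ### Velocities of paths -/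

namespace IsPath

variable {u : ℝ → GL (Fin m) ℝ} {p q : HodgeStructure m 𝒟.k}

theorem hasDerivAt (hu : 𝒟.IsPath u p q) {t : ℝ} (ht : t ∈ Set.Ioo (0 : ℝ) 1) (i j : Fin m) :
    HasDerivAt (fun s => u s i j)
      (((u t : Matrix (Fin m) (Fin m) ℝ) * velocity u t) i j) t := by
  have hnhds : Set.Icc (0 : ℝ) 1 ∈ nhds t := Icc_mem_nhds ht.1 ht.2
  have hd : DifferentiableWithinAt ℝ (fun s => u s i j) (Set.Icc (0 : ℝ) 1) t :=
    (hu.smooth i j).differentiableOn one_ne_zero t (Set.Ioo_subset_Icc_self ht)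
  have h1 : (u t : Matrix (Fin m) (Fin m) ℝ) * velocity u t =
      Matrix.of fun i j => derivWithin (fun s => u s i j) (Set.Icc (0 : ℝ) 1) t := by
    rw [velocity, ← Matrix.mul_assoc, Units.mul_inv, Matrix.one_mul]
  rw [h1]
  exact hd.hasDerivWithinAt.hasDerivAt hnhds

theorem velocity_mem_lie (hu : 𝒟.IsPath u p q) {t : ℝ} (ht : t ∈ Set.Ioo (0 : ℝ) 1) :
    velocity u t ∈ 𝒟.lie := by
  classical
  -- The value 1 keeps the curve in the group for every s; as t is interior, it does not affect the
  -- derivative at 0.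
  refine ⟨fun s => if t + s ∈ Set.Icc (0 : ℝ) 1 then (u t)⁻¹ * u (t + s) else 1, ?_, ?_, ?_⟩
  · simp
  · intro s
    dsimp only
    split_ifs with hs
    · exact mul_mem (inv_mem (hu.mem t (Set.Ioo_subset_Icc_self ht))) (hu.mem _ hs)
    · exact one_mem _
  · intro i j
    have hev : (fun s => (if t + s ∈ Set.Icc (0 : ℝ) 1 then (u t)⁻¹ * u (t + s) else 1 :
        GL (Fin m) ℝ) i j) =ᶠ[nhds 0]
        fun s => ∑ l, (((u t)⁻¹ : GL (Fin m) ℝ) : Matrix (Fin m) (Fin m) ℝ) i l * u (t + s) l j := by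
      have hc : Filter.Tendsto (fun s : ℝ => t + s) (nhds 0) (nhds t) := by
        have : Continuous fun s : ℝ => t + s := by fun_prop
        simpa using this.tendsto 0
      filter_upwards [hc.eventually (Icc_mem_nhds ht.1 ht.2)] with s hs
      rw [if_pos (show t + s ∈ Set.Icc (0 : ℝ) 1 from hs)]
      simp only [Units.val_mul, Matrix.mul_apply]
    refine HasDerivAt.congr_of_eventuallyEq ?_ hev
    have hX : velocity u t i j = ∑ l, (((u t)⁻¹ : GL (Fin m) ℝ) : Matrix (Fin m) (Fin m) ℝ) i l *
        ((u t : Matrix (Fin m) (Fin m) ℝ) * velocity u t) l j := by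
      rw [← Matrix.mul_apply, ← Matrix.mul_assoc, Units.inv_mul, Matrix.one_mul]
    rw [hX]
    refine HasDerivAt.fun_sum fun l _ => HasDerivAt.const_mul _ ?_
    have hd := hu.hasDerivAt ht l j
    refine HasDerivAt.comp_const_add (f := fun r => u r l j) t 0 ?_
    rwa [add_zero]

theorem continuousOn_coe (hu : 𝒟.IsPath u p q) :
    ContinuousOn (fun t => (u t : Matrix (Fin m) (Fin m) ℝ)) (Set.Icc 0 1) :=
  continuousOn_pi.2 fun i => continuousOn_pi.2 fun j => (hu.smooth i j).continuousOn

theorem continuousOn_inv (hu : 𝒟.IsPath u p q) :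
    ContinuousOn (fun t => (((u t)⁻¹ : GL (Fin m) ℝ) : Matrix (Fin m) (Fin m) ℝ))
      (Set.Icc 0 1) := by
  intro t ht
  have h1 : (fun t => (((u t)⁻¹ : GL (Fin m) ℝ) : Matrix (Fin m) (Fin m) ℝ)) =
      fun t => (u t : Matrix (Fin m) (Fin m) ℝ).det⁻¹ •
        (u t : Matrix (Fin m) (Fin m) ℝ).adjugate := by
    funext s
    rw [Matrix.coe_units_inv, Matrix.inv_def, Ring.inverse_eq_inv']
  rw [h1]
  have hdet : (u t : Matrix (Fin m) (Fin m) ℝ).det ≠ 0 :=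
    ((Matrix.isUnit_iff_isUnit_det _).1 (u t).isUnit).ne_zero
  have hc : ContinuousWithinAt (fun t => (u t : Matrix (Fin m) (Fin m) ℝ)) (Set.Icc 0 1) t :=
    hu.continuousOn_coe t ht
  have hd : ContinuousWithinAt (fun t => (u t : Matrix (Fin m) (Fin m) ℝ).det) (Set.Icc 0 1) t :=
    (continuous_id.matrix_det.continuousAt).comp_continuousWithinAt hc
  have ha : ContinuousWithinAt (fun t => (u t : Matrix (Fin m) (Fin m) ℝ).adjugate)
      (Set.Icc 0 1) t := (continuous_id.matrix_adjugate.continuousAt).comp_continuousWithinAt hc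
  exact (hd.inv₀ hdet).smul ha

/-- Continuity up to the end points makes the speed integrable, as needed for integrating the
differential inequality in `energy_le`. -/
theorem continuousOn_velocity (hu : 𝒟.IsPath u p q) :
    ContinuousOn (velocity u) (Set.Icc 0 1) := by
  have h1 : ContinuousOn (fun t => (Matrix.of fun i j =>
      derivWithin (fun s => u s i j) (Set.Icc (0 : ℝ) 1) t : Matrix (Fin m) (Fin m) ℝ))
      (Set.Icc 0 1) :=
    continuousOn_pi.2 fun i => continuousOn_pi.2 fun j =>
      (hu.smooth i j).continuousOn_derivWithin (uniqueDiffOn_Icc one_pos) le_rfl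
  exact hu.continuousOn_inv.mul h1

end IsPath

theorem InvariantMetric.continuous_form_self (b : 𝒟.InvariantMetric) :
    Continuous fun X => b.form X X := by
  have h0 : ∀ X Y, b.form X Y = ∑ i, ∑ j, X i j * b.form (Matrix.single i j 1) Y := by
    intro X Y
    conv_lhs => rw [Matrix.matrix_eq_sum_single X]
    simp only [map_sum, LinearMap.sum_apply]
    refine Finset.sum_congr rfl fun i _ => Finset.sum_congr rfl fun j _ => ?_
    have : Matrix.single i j (X i j) = X i j • Matrix.single i j (1 : ℝ) := by
      rw [Matrix.smul_single, smul_eq_mul, mul_one]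
    rw [this, map_smul, LinearMap.smul_apply, smul_eq_mul]
  have h1 : ∀ X, b.form X X = ∑ i, ∑ j, X i j * b.form (Matrix.single i j 1) X :=
    fun X => h0 X X
  simp only [h1]
  refine continuous_finsetSum _ fun i _ => continuous_finsetSum _ fun j _ => ?_
  exact (continuous_id.matrix_elem i j).mul (LinearMap.continuous_of_finiteDimensional _)

end Datum

end PeriodDomain

/-! ### Growth of the Hodge norm along a path -/

namespace PeriodDomain

open scoped Matrix.Norms.Operator in
/-- The derivative of a curve of conjugates `U C U⁻¹`. -/
theorem hasDerivAt_mul_mul_inv {m : ℕ} {U : ℝ → GL (Fin m) ℂ} {X : Matrix (Fin m) (Fin m) ℂ} {t : ℝ}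
    (hU : ∀ i j, HasDerivAt (fun s => (U s : Matrix (Fin m) (Fin m) ℂ) i j)
      (((U t : Matrix (Fin m) (Fin m) ℂ) * X) i j) t) (C : Matrix (Fin m) (Fin m) ℂ) (i j : Fin m) :
    HasDerivAt (fun s => ((U s : Matrix (Fin m) (Fin m) ℂ) * C * ((U s)⁻¹ : GL (Fin m) ℂ)) i j)
      (((U t : Matrix (Fin m) (Fin m) ℂ) * (X * C - C * X) * ((U t)⁻¹ : GL (Fin m) ℂ)) i j) t := by
  have h1 : HasDerivAt (fun s => (U s : Matrix (Fin m) (Fin m) ℂ))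
      ((U t : Matrix (Fin m) (Fin m) ℂ) * X) t :=
    hasDerivAt_pi.2 fun i => hasDerivAt_pi.2 fun j => hU i j
  have h2 : HasDerivAt (fun s => (((U s)⁻¹ : GL (Fin m) ℂ) : Matrix (Fin m) (Fin m) ℂ))
      (-(X * ((U t)⁻¹ : GL (Fin m) ℂ))) t := by
    have h3 := (hasFDerivAt_ringInverse (𝕜 := ℝ) (U t)).comp_hasDerivAt t h1
    have e1 : Ring.inverse ∘ (fun s => (U s : Matrix (Fin m) (Fin m) ℂ)) =
        fun s => (((U s)⁻¹ : GL (Fin m) ℂ) : Matrix (Fin m) (Fin m) ℂ) := by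
      funext s
      simp
    rw [e1] at h3
    refine h3.congr_deriv ?_
    simp only [_root_.neg_apply, ContinuousLinearMap.mulLeftRight_apply]
    rw [← mul_assoc, Units.inv_mul, one_mul]
  have h4 := (h1.mul_const C).mul h2
  have h5 := hasDerivAt_pi.1 (hasDerivAt_pi.1 h4 i) j
  refine h5.congr_deriv ?_
  simp only [Matrix.mul_sub, Matrix.sub_mul, Matrix.mul_neg, Matrix.mul_assoc]
  abel

namespace Datum

variable {m : ℕ} {𝒟 : Datum m} {u : ℝ → GL (Fin m) ℝ} {p q : HodgeStructure m 𝒟.k}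

/-- The Hodge norm square of `v` along the path `t ↦ u t • base`. -/
noncomputable def energy (𝒟 : Datum m) (u : ℝ → GL (Fin m) ℝ) (v : Fin m → ℂ) (t : ℝ) : ℝ :=
  (star v ⬝ᵥ (HodgeStructure.act (u t) 𝒟.base).gram 𝒟.Q *ᵥ v).re

/-- The linear functional `M ↦ Re (v^* Mᵀ Q v)`, which sends a Weil operator to the Hodge norm
square of `v`. -/
noncomputable def formAt (Q : Matrix (Fin m) (Fin m) ℤ) (v : Fin m → ℂ)
    (M : Matrix (Fin m) (Fin m) ℂ) : ℝ :=
  (star v ⬝ᵥ (Mᵀ * intCplx Q) *ᵥ v).re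

/-- Written in entries of M, the functional is visibly real-linear, so derivatives and continuity
can be taken entrywise. -/
theorem formAt_eq_sum (Q : Matrix (Fin m) (Fin m) ℤ) (v : Fin m → ℂ)
    (M : Matrix (Fin m) (Fin m) ℂ) :
    formAt Q v M = (∑ j, ∑ i, M i j * (star (v j) * (intCplx Q *ᵥ v) i)).re := by
  rw [formAt, ← Matrix.mulVec_mulVec]
  simp only [dotProduct, Matrix.mulVec, Matrix.transpose_apply, Finset.mul_sum, Pi.star_apply]
  congr 1
  refine Finset.sum_congr rfl fun j _ => Finset.sum_congr rfl fun i _ =>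
    Finset.sum_congr rfl fun l _ => by ring

theorem energy_eq_formAt (v : Fin m → ℂ) (t : ℝ) : energy 𝒟 u v t =
    formAt 𝒟.Q v ((toC (u t) : Matrix (Fin m) (Fin m) ℂ) * 𝒟.base.weil *
      ((toC (u t))⁻¹ : GL (Fin m) ℂ)) := by
  rw [energy, HodgeStructure.gram, HodgeStructure.weil_act, formAt]

theorem hasDerivAt_formAt {Q : Matrix (Fin m) (Fin m) ℤ} {v : Fin m → ℂ}
    {M : ℝ → Matrix (Fin m) (Fin m) ℂ} {M' : Matrix (Fin m) (Fin m) ℂ} {t : ℝ}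
    (hM : ∀ i j, HasDerivAt (fun s => M s i j) (M' i j) t) :
    HasDerivAt (fun s => formAt Q v (M s)) (formAt Q v M') t := by
  simp only [formAt_eq_sum]
  have : HasDerivAt (fun s => ∑ j, ∑ i, M s i j * (star (v j) * (intCplx Q *ᵥ v) i))
      (∑ j, ∑ i, M' i j * (star (v j) * (intCplx Q *ᵥ v) i)) t :=
    HasDerivAt.fun_sum fun j _ => HasDerivAt.fun_sum fun i _ => (hM i j).mul_const _
  exact Complex.reCLM.hasFDerivAt.comp_hasDerivAt t this

theorem exists_eq_toC_mulVec (g : GL (Fin m) ℝ) (v : Fin m → ℂ) :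
    ∃ w, v = (toC g : Matrix (Fin m) (Fin m) ℂ) *ᵥ w := by
  refine ⟨(((toC g)⁻¹ : GL (Fin m) ℂ) : Matrix (Fin m) (Fin m) ℂ) *ᵥ v, ?_⟩
  rw [Matrix.mulVec_mulVec, Units.mul_inv, Matrix.one_mulVec]

/-- The Hodge form of a point of the domain is positive definite. -/
theorem re_dotProduct_gram_act_pos {g : GL (Fin m) ℝ} (hg : g ∈ 𝒟.realPlus) {v : Fin m → ℂ}
    (hv : v ≠ 0) : 0 < (star v ⬝ᵥ (HodgeStructure.act g 𝒟.base).gram 𝒟.Q *ᵥ v).re := by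
  obtain ⟨ν, hν0, hν⟩ := 𝒟.exists_pos_multiplier hg
  obtain ⟨w, rfl⟩ := exists_eq_toC_mulVec g v
  have hw : w ≠ 0 := by
    rintro rfl
    simp at hv
  rw [𝒟.base.dotProduct_gram_act_mulVec g hν]
  exact mul_pos hν0 (𝒟.polarized.re_dotProduct_gram_mulVec_pos hw)

/-- The logarithmic derivative of the Hodge norm is bounded by the Hodge speed of the path. -/
theorem IsPath.exists_hasDerivAt_energy (hu : 𝒟.IsPath u p q) (v : Fin m → ℂ) {t : ℝ}
    (ht : t ∈ Set.Ioo (0 : ℝ) 1) :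
    ∃ e : ℝ, HasDerivAt (energy 𝒟 u v) e t ∧
      |e| ≤ 2 * √(𝒟.base.hodgeSq 𝒟.Q (velocity u t)) * energy 𝒟 u v t := by
  set X := velocity u t with hX
  set C := 𝒟.base.weil with hC
  have hU : ∀ i j, HasDerivAt (fun s => (toC (u s) : Matrix (Fin m) (Fin m) ℂ) i j)
      (((toC (u t) : Matrix (Fin m) (Fin m) ℂ) * cplx X) i j) t := by
    intro i j
    have h1 := (hu.hasDerivAt ht i j).ofReal_comp
    rw [coe_toC, ← cplx_mul]
    exact h1
  have hd := hasDerivAt_formAt (Q := 𝒟.Q) (v := v) (hasDerivAt_mul_mul_inv hU C)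
  have hfun : energy 𝒟 u v = fun s => formAt 𝒟.Q v ((toC (u s) : Matrix (Fin m) (Fin m) ℂ) * C *
      ((toC (u s))⁻¹ : GL (Fin m) ℂ)) := funext fun s => energy_eq_formAt v s
  refine ⟨_, hfun ▸ hd, ?_⟩
  obtain ⟨ν, hν0, hν⟩ := 𝒟.exists_pos_multiplier (hu.mem t (Set.Ioo_subset_Icc_self ht))
  -- Transport to the base point: the energy and its derivative both scale by the same ν > 0, so the
  -- bound at the base applies.
  obtain ⟨w, rfl⟩ := exists_eq_toC_mulVec (u t) v
  have hreal : conjM (toC (u t) : Matrix (Fin m) (Fin m) ℂ) = toC (u t) := by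
    ext i j
    simp [conjM, toC]
  have hE : energy 𝒟 u ((toC (u t) : Matrix (Fin m) (Fin m) ℂ) *ᵥ w) t =
      ν * (star w ⬝ᵥ 𝒟.base.gram 𝒟.Q *ᵥ w).re :=
    𝒟.base.dotProduct_gram_act_mulVec (u t) hν w
  have hF : formAt 𝒟.Q ((toC (u t) : Matrix (Fin m) (Fin m) ℂ) *ᵥ w)
      ((toC (u t) : Matrix (Fin m) (Fin m) ℂ) * (cplx X * C - C * cplx X) *
        ((toC (u t))⁻¹ : GL (Fin m) ℂ)) =
      ν * (star w ⬝ᵥ ((cplx X * C - C * cplx X)ᵀ * intCplx 𝒟.Q) *ᵥ w).re := by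
    have e : (toC (u t) : Matrix (Fin m) (Fin m) ℂ)ᵀ *
        (((toC (u t) : Matrix (Fin m) (Fin m) ℂ) * (cplx X * C - C * cplx X) *
        (((toC (u t))⁻¹ : GL (Fin m) ℂ) : Matrix (Fin m) (Fin m) ℂ))ᵀ * intCplx 𝒟.Q) * toC (u t) =
        (ν : ℂ) • ((cplx X * C - C * cplx X)ᵀ * intCplx 𝒟.Q) := by
      have : (toC (u t) : Matrix (Fin m) (Fin m) ℂ)ᵀ *
          (((toC (u t))⁻¹ : GL (Fin m) ℂ) : Matrix (Fin m) (Fin m) ℂ)ᵀ = 1 := by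
        rw [← Matrix.transpose_mul, Units.inv_mul, Matrix.transpose_one]
      rw [Matrix.transpose_mul, Matrix.transpose_mul, ← Matrix.mul_assoc, ← Matrix.mul_assoc, this,
        Matrix.one_mul, Matrix.mul_assoc, Matrix.mul_assoc, ← Matrix.mul_assoc _ (intCplx 𝒟.Q), hν,
        Matrix.mul_smul]
    rw [formAt, star_mulVec_eq_conjM_mulVec, hreal, ← Matrix.vecMul_transpose,
      ← Matrix.dotProduct_mulVec, Matrix.mulVec_mulVec, Matrix.mulVec_mulVec, e,
      Matrix.smul_mulVec, dotProduct_smul, smul_eq_mul, Complex.re_ofReal_mul]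
  rw [hF, hE, abs_mul, abs_of_pos hν0]
  have := (Complex.abs_re_le_norm _).trans (𝒟.polarized.norm_dotProduct_commutator_le X w)
  calc _ ≤ ν * (2 * √(𝒟.base.hodgeSq 𝒟.Q X) * (star w ⬝ᵥ 𝒟.base.gram 𝒟.Q *ᵥ w).re) :=
        mul_le_mul_of_nonneg_left this hν0.le
    _ = _ := by ring

theorem IsPath.continuousOn_energy (hu : 𝒟.IsPath u p q) (v : Fin m → ℂ) :
    ContinuousOn (energy 𝒟 u v) (Set.Icc 0 1) := by
  have hc : Continuous (cplx (m := m)) := continuous_id.matrix_map Complex.continuous_ofReal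
  have h1 : ContinuousOn (fun s => (toC (u s) : Matrix (Fin m) (Fin m) ℂ)) (Set.Icc 0 1) :=
    hc.comp_continuousOn hu.continuousOn_coe
  have h2 : ContinuousOn (fun s => (((toC (u s))⁻¹ : GL (Fin m) ℂ) : Matrix (Fin m) (Fin m) ℂ))
      (Set.Icc 0 1) := by
    simp only [← map_inv]
    exact hc.comp_continuousOn hu.continuousOn_inv
  have h3 := (h1.mul (continuousOn_const (c := 𝒟.base.weil))).mul h2
  have h4 : Continuous (formAt 𝒟.Q v) := by
    rw [funext (formAt_eq_sum 𝒟.Q v)]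
    refine Complex.continuous_re.comp (continuous_finsetSum _ fun j _ =>
      continuous_finsetSum _ fun i _ => (continuous_id.matrix_elem i j).mul continuous_const)
  exact (h4.comp_continuousOn h3).congr fun s _ => energy_eq_formAt v s

/-- The Hodge norms at the end points of a path differ by at most the exponential of its length. -/
theorem IsPath.energy_le (hu : 𝒟.IsPath u p q) (b : 𝒟.InvariantMetric) {c : ℝ} (hc : 0 < c)
    (hb : b.Dominates c) {v : Fin m → ℂ} (hv : v ≠ 0) :
    energy 𝒟 u v 0 ≤ Real.exp (2 / c * b.length u) * energy 𝒟 u v 1 := by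
  have hpos : ∀ t ∈ Set.Icc (0 : ℝ) 1, 0 < energy 𝒟 u v t := fun t ht =>
    re_dotProduct_gram_act_pos (hu.mem t ht) hv
  choose! e he hle using fun t ht => hu.exists_hasDerivAt_energy v (t := t) ht
  set φ : ℝ → ℝ := fun t => 2 / c * √(b.form (velocity u t) (velocity u t)) with hφ
  have hφc : ContinuousOn φ (Set.Icc 0 1) :=
    continuousOn_const.mul (Real.continuous_sqrt.comp_continuousOn
      (b.continuous_form_self.comp_continuousOn hu.continuousOn_velocity))
  -- Grönwall in logarithmic form. The minus sign is there because the initial energy is to be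
  -- bounded by the final one.
  have key := intervalIntegral.sub_le_integral_of_hasDeriv_right_of_le
    (g := fun t => -Real.log (energy 𝒟 u v t)) (g' := fun t => -(e t / energy 𝒟 u v t)) (φ := φ)
    zero_le_one ((hu.continuousOn_energy v).log fun t ht => (hpos t ht).ne').neg
    (fun t ht => ((he t ht).log (hpos t (Set.Ioo_subset_Icc_self ht)).ne').neg.hasDerivWithinAt)
    (hφc.integrableOn_compact isCompact_Icc) (by
      intro t ht
      have hE := hpos t (Set.Ioo_subset_Icc_self ht)
      have h1 : -(e t / energy 𝒟 u v t) ≤ 2 * √(𝒟.base.hodgeSq 𝒟.Q (velocity u t)) := by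
        rw [← neg_div, div_le_iff₀ hE]
        exact (neg_le_abs _).trans (hle t ht)
      refine h1.trans ?_
      have h2 := Real.sqrt_le_sqrt (hb _ (hu.velocity_mem_lie ht))
      rw [Real.sqrt_mul (sq_nonneg c), Real.sqrt_sq hc.le] at h2
      have h3 : φ t = 2 * (√(b.form (velocity u t) (velocity u t)) / c) := by
        simp only [hφ]; ring
      rw [h3]
      refine mul_le_mul_of_nonneg_left ?_ (by norm_num)
      rw [le_div_iff₀ hc, mul_comm]
      exact h2)
  have hint : ∫ t in (0 : ℝ)..1, φ t = 2 / c * b.length u :=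
    intervalIntegral.integral_const_mul _ _
  rw [hint] at key
  have h0 := hpos 0 (by simp)
  have h1 := hpos 1 (by simp)
  have : Real.log (energy 𝒟 u v 0) ≤ 2 / c * b.length u + Real.log (energy 𝒟 u v 1) := by
    linarith
  calc energy 𝒟 u v 0 = Real.exp (Real.log (energy 𝒟 u v 0)) := (Real.exp_log h0).symm
    _ ≤ Real.exp (2 / c * b.length u + Real.log (energy 𝒟 u v 1)) := Real.exp_le_exp.2 this
    _ = _ := by rw [Real.exp_add, Real.exp_log h1]

/-! ### Eigenvalues of elements of arithmetic groups -/

/-- A positive power of an element of an arithmetic group is an integral matrix of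
determinant `±1`. -/
theorem IsArithmetic.exists_pow_eq_intToRat {Γ : Subgroup (GL (Fin m) ℚ)} (hΓ : 𝒟.IsArithmetic Γ)
    {γ : GL (Fin m) ℚ} (hγ : γ ∈ Γ) : ∃ N : ℕ, 0 < N ∧ ∃ M : GL (Fin m) ℤ, γ ^ N = intToRat M := by
  have hne : (𝒟.intPoints.relIndex Γ) ≠ 0 := hΓ.commensurable.2
  obtain ⟨N, hN, -, hmem⟩ := Subgroup.exists_pow_mem_of_relIndex_ne_zero hne hγ
  obtain ⟨M, hM⟩ := hmem.1.2
  exact ⟨N, hN, M, hM.symm⟩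

/-- Some power of det γ is a unit of ℤ; after squaring, the number is nonnegative and a power equal
to 1 forces it to be 1. -/
theorem IsArithmetic.det_sq_eq_one {Γ : Subgroup (GL (Fin m) ℚ)} (hΓ : 𝒟.IsArithmetic Γ)
    {γ : GL (Fin m) ℚ} (hγ : γ ∈ Γ) : (ratToReal γ : Matrix (Fin m) (Fin m) ℝ).det ^ 2 = 1 := by
  obtain ⟨N, hN, M, hM⟩ := hΓ.exists_pow_eq_intToRat hγ
  have h1 : (γ : Matrix (Fin m) (Fin m) ℚ).det ^ N =
      ((M : Matrix (Fin m) (Fin m) ℤ).det : ℚ) := by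
    have := congrArg (fun x : GL (Fin m) ℚ => (x : Matrix (Fin m) (Fin m) ℚ).det) hM
    simp only [Units.val_pow_eq_pow_val, Matrix.det_pow] at this
    rw [this]
    exact (RingHom.map_det (algebraMap ℤ ℚ) (M : Matrix (Fin m) (Fin m) ℤ)).symm
  have h2 : ((M : Matrix (Fin m) (Fin m) ℤ).det) ^ 2 = 1 := by
    have := (Matrix.isUnit_iff_isUnit_det _).1 M.isUnit
    rcases Int.isUnit_iff.1 this with h | h <;> rw [h] <;> norm_num
  have h3 : ((γ : Matrix (Fin m) (Fin m) ℚ).det ^ 2) ^ N = 1 := by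
    rw [← pow_mul, mul_comm, pow_mul, h1]
    exact_mod_cast h2
  have h4 : (γ : Matrix (Fin m) (Fin m) ℚ).det ^ 2 = 1 :=
    (pow_eq_one_iff_of_nonneg (sq_nonneg _) hN.ne').1 h3
  have h5 : (ratToReal γ : Matrix (Fin m) (Fin m) ℝ).det =
      (((γ : Matrix (Fin m) (Fin m) ℚ).det : ℚ) : ℝ) :=
    (RingHom.map_det (algebraMap ℚ ℝ) (γ : Matrix (Fin m) (Fin m) ℚ)).symm
  rw [h5]
  exact_mod_cast h4

/-- The eigenvalues of an element of an arithmetic group are bounded by the exponential of its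
translation lengths. -/
theorem norm_eigenvalue_le {Γ : Subgroup (GL (Fin m) ℚ)} (hΓ : 𝒟.IsArithmetic Γ)
    {γ : GL (Fin m) ℚ} (hγ : γ ∈ Γ) (b : 𝒟.InvariantMetric) {c : ℝ} (hc : 0 < c)
    (hb : b.Dominates c) (hu : 𝒟.IsPath u p (HodgeStructure.act (ratToReal γ) p))
    {z : ℂ} (hz : ((γ : Matrix (Fin m) (Fin m) ℚ).map (algebraMap ℚ ℂ)).charpoly.IsRoot z) :
    ‖z‖ ≤ Real.exp (b.length u / c) := by
  obtain ⟨v, hv, hzv⟩ := Matrix.exists_mulVec_eq_smul_of_isRoot_charpoly hz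
  set g : GL (Fin m) ℝ := ratToReal γ with hg
  have hcoe : (toC g : Matrix (Fin m) (Fin m) ℂ) =
      (γ : Matrix (Fin m) (Fin m) ℚ).map (algebraMap ℚ ℂ) := by
    ext i j
    simp [hg, toC, ratToReal]
  -- γ need not lie in the identity component, so `exists_pos_multiplier` does not apply. The sign
  -- of ν comes instead from `hmul` and the positivity of the Hodge forms at both ends.
  obtain ⟨ν, hν0, hν⟩ := 𝒟.exists_multiplier (hΓ.le hγ : g ∈ 𝒟.realPoints)
  have hE0 : energy 𝒟 u v 0 = (star v ⬝ᵥ p.gram 𝒟.Q *ᵥ v).re := by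
    rw [energy, hu.source]
  have hE1 : ∀ x, energy 𝒟 u x 1 =
      (star x ⬝ᵥ (HodgeStructure.act g p).gram 𝒟.Q *ᵥ x).re := by
    intro x
    rw [energy, hu.target]
  have hpos0 : 0 < energy 𝒟 u v 0 := re_dotProduct_gram_act_pos (hu.mem 0 (by simp)) hv
  have hpos1 : 0 < energy 𝒟 u v 1 := re_dotProduct_gram_act_pos (hu.mem 1 (by simp)) hv
  have hmul : ‖z‖ ^ 2 * energy 𝒟 u v 1 = ν * energy 𝒟 u v 0 := by
    have h1 := p.dotProduct_gram_act_mulVec g hν v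
    rw [hcoe, hzv, ← hE0] at h1
    rw [← h1, hE1, star_smul, Matrix.mulVec_smul, smul_dotProduct, dotProduct_smul, smul_smul,
      smul_eq_mul]
    have : star z * z = ((‖z‖ ^ 2 : ℝ) : ℂ) := by
      rw [Complex.star_def, mul_comm, Complex.mul_conj, Complex.normSq_eq_norm_sq]
    rw [this, Complex.re_ofReal_mul]
  have hm : m ≠ 0 := by
    rintro rfl
    exact hv (Subsingleton.elim _ _)
  have hνnn : 0 ≤ ν := by
    by_contra! hneg
    have h1 : ν * energy 𝒟 u v 0 < 0 := mul_neg_of_neg_of_pos hneg hpos0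
    have h2 : 0 ≤ ‖z‖ ^ 2 * energy 𝒟 u v 1 := mul_nonneg (sq_nonneg _) hpos1.le
    linarith
  have hdet : (g : Matrix (Fin m) (Fin m) ℝ).det ^ 2 = 1 := hΓ.det_sq_eq_one hγ
  have hν1 : ν = 1 := by
    have := multiplier_pow_eq_det_sq hν
    rw [hdet] at this
    exact (pow_eq_one_iff_of_nonneg hνnn hm).1 this
  have hle := hu.energy_le b hc hb hv
  rw [hν1, one_mul] at hmul
  rw [← hmul] at hle
  have hsq := le_of_mul_le_mul_right hle hpos1
  have : Real.exp (2 / c * b.length u) = Real.exp (b.length u / c) ^ 2 := by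
    rw [← Real.exp_nat_mul]
    congr 1
    push_cast
    ring
  rw [this] at hsq
  exact (pow_le_pow_iff_left₀ (norm_nonneg _) (Real.exp_pos _).le two_ne_zero).1 hsq

end Datum

end PeriodDomain

/-! ### The displacement bound -/

theorem mainTheorem6 (n : ℕ) :
    ∃ μ : ℝ, 0 < μ ∧
      ∀ (m : ℕ), m ≤ n → ∀ (𝒟 : PeriodDomain.Datum m) (b : 𝒟.InvariantMetric) (c : ℝ),
        0 < c → b.Dominates c →
        ∀ Γ : Subgroup (GL (Fin m) ℚ), 𝒟.IsArithmetic Γ →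
        ∀ p ∈ 𝒟.domain, ∀ γ ∈ Γ, ¬ PeriodDomain.IsQuasiUnipotent γ →
          ENNReal.ofReal (c * μ) <
            b.dist p (PeriodDomain.HodgeStructure.act (PeriodDomain.ratToReal γ) p) := by
  obtain ⟨B, hB1, hB⟩ := exists_pow_eq_one_of_norm_conjugates_le n
  -- Chosen so that ℓ/c < L gives exp(ℓ/c)^n < B; the denominator n + 1 also covers n = 0. Halving
  -- `L` below turns the weak bound on the infimum into a strict one.
  set L : ℝ := Real.log B / (n + 1) with hL
  have hLpos : 0 < L := div_pos (Real.log_pos hB1) (by positivity)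
  refine ⟨L / 2, by positivity, ?_⟩
  intro m hmn 𝒟 b c hc hb Γ hΓ p _ γ hγ hqu
  suffices h : ENNReal.ofReal (c * L) ≤
      b.dist p (PeriodDomain.HodgeStructure.act (PeriodDomain.ratToReal γ) p) by
    refine lt_of_lt_of_le ?_ h
    rw [ENNReal.ofReal_lt_ofReal_iff (by positivity)]
    exact mul_lt_mul_of_pos_left (by linarith) hc
  refine le_iInf₂ fun u hu => ENNReal.ofReal_le_ofReal ?_
  by_contra! hlt
  apply hqu
  refine Matrix.exists_isNilpotent_pow_sub_one _ fun z hz => ?_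
  have hlen : 0 ≤ b.length u :=
    intervalIntegral.integral_nonneg zero_le_one fun t _ => Real.sqrt_nonneg _
  have hcp : ((γ : Matrix (Fin m) (Fin m) ℚ).map (algebraMap ℚ ℂ)).charpoly =
      (γ : Matrix (Fin m) (Fin m) ℚ).charpoly.map (algebraMap ℚ ℂ) :=
    Matrix.charpoly_map _ (algebraMap ℚ ℂ)
  have hroot : ∀ y : ℂ, Polynomial.aeval y (γ : Matrix (Fin m) (Fin m) ℚ).charpoly = 0 ↔
      ((γ : Matrix (Fin m) (Fin m) ℚ).map (algebraMap ℚ ℂ)).charpoly.IsRoot y := by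
    intro y
    rw [hcp, Polynomial.IsRoot.def, Polynomial.eval_map, Polynomial.aeval_def]
  -- This bounds the degree of z by m and makes every conjugate of z an eigenvalue of γ, subject to
  -- the same norm bound.
  have hdvd : minpoly ℚ z ∣ (γ : Matrix (Fin m) (Fin m) ℚ).charpoly :=
    minpoly.dvd ℚ z ((hroot z).2 hz)
  obtain ⟨N, hN, M, hM⟩ := hΓ.exists_pow_eq_intToRat hγ
  have hint : IsIntegral ℤ z :=
    Matrix.isIntegral_of_isRoot_charpoly_of_pow_eq hN
      (M := (M : Matrix (Fin m) (Fin m) ℤ)) (by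
        rw [← Units.val_pow_eq_pow_val, hM]; rfl) hz
  have hz0 : z ≠ 0 := by
    rintro rfl
    obtain ⟨v, hv, hv0⟩ := Matrix.exists_mulVec_eq_smul_of_isRoot_charpoly hz
    rw [zero_smul] at hv0
    have h0 : (algebraMap ℚ ℂ) (γ : Matrix (Fin m) (Fin m) ℚ).det = 0 :=
      (RingHom.map_det (algebraMap ℚ ℂ) _).trans (Matrix.exists_mulVec_eq_zero_iff.1 ⟨v, hv, hv0⟩)
    rw [map_eq_zero] at h0
    exact ((Matrix.isUnit_iff_isUnit_det _).1 γ.isUnit).ne_zero h0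
  refine hB z (Real.exp (b.length u / c)) hint hz0 ?_ ?_ ?_ ?_
  · refine (Polynomial.natDegree_le_of_dvd hdvd (Matrix.charpoly_monic _).ne_zero).trans ?_
    rw [Matrix.charpoly_natDegree_eq_dim, Fintype.card_fin]
    exact hmn
  · exact Real.one_le_exp (by positivity)
  · rw [← Real.exp_nat_mul, ← Real.lt_log_iff_exp_lt (by linarith)]
    have h1 : b.length u / c < L := by rwa [div_lt_iff₀ hc, mul_comm]
    calc (n : ℝ) * (b.length u / c) ≤ (n + 1) * (b.length u / c) := by
          refine mul_le_mul_of_nonneg_right (by linarith) (by positivity)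
      _ < (n + 1) * L := mul_lt_mul_of_pos_left h1 (by positivity)
      _ = Real.log B := by rw [hL]; field_simp
  · intro y hy
    obtain ⟨r, hr⟩ := hdvd
    refine PeriodDomain.Datum.norm_eigenvalue_le hΓ hγ b hc hb hu ((hroot y).1 ?_)
    rw [hr, map_mul, hy, zero_mul]
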